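/- Setting. All graphs $G=(V,E)$ are finite, simple and undirected, with initial vertex labels $\ell_0:V\to\mathbb N$ and edge weights $w:E\to\mathbb R_{\ge 0}$. Fix $k\ge 1$, reals $\alpha_1\ge\dots\ge\alpha_k=0$, $\gamma\ge 0$ and a depth $h\in\mathbb N$. The filtration graphs of $G$ are $G_j=(V,\{e\in E: w(e)\ge\alpha_j\})$, $1\le j\le k$. On each graph, the Weisfeiler-Lehman (WL) labels are $\ell_{i+1}(v)=f_\#(\ell_i(v),\{\!\{\ell_i(u):u\in\mathcal N(v)\}\!\})\in\Sigma_{i+1}$, where $f_\#$ is a perfect (injective) hash, the same for all graphs, and the alphabets $\Sigma_0=\mathbb N,\Sigma_1,\Sigma_2,\dots$ are regarded as pairwise disjoint. Let $\mathcal F_{WL}=\Sigma_{i_0}\cup\dots\cup\Sigma_h$, where $i_0=1$, or $i_0=0$ if the original labels are to be counted as features (the theorem holds for both choices). For $f\in\mathcal F_{WL}$ let $\phi_f(G)\in\mathbb R^k$ be the histogram whose $j$-th entry is the number of vertices of $G_j$ with label $f$, and let $\hat\phi_f(G)=\phi_f(G)/\|\phi_f(G)\|_1$. The Weisfeiler-Lehman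 filtration kernel is $$K(G,G')=\sum_{f\in\mathcal F_{WL}} e^{-\gamma\,\mathcal W(\hat\phi_f(G),\hat\phi_f(G'))}\,\|\phi_f(G)\|_1\,\|\phi_f(G')\|_1 ,$$ where terms with $\|\phi_f(G)\|_1=0$ or $\|\phi_f(G')\|_1=0$ count as $0$, and $$\mathcal W(x,x')=\min\Big\{\sum_{i,j}T_{ij}|\alpha_i-\alpha_j| \;:\; T\in\mathbb R_{\ge0}^{k\times k},\ T\mathbf 1=x,\ \mathbf 1^{\top}T=x'^{\top}\Big\}.$$ Machine model. A unit-cost real RAM: a fixed finite number of arrays (of unbounded length, initially zero outside the input) of natural numbers and of reals, with indirect addressing; addition, truncated subtraction and comparison of natural numbers; $+,-,\times,/,\exp$ and comparison of reals; each operation, constant, memory access, assignment and test costs one step. The input consists of $h$, $k$, $\gamma$, $\alpha_1,\dots,\alpha_k$, and, for each of $G$ and $G'$, the numbers of vertices and edges, the vertex labels, and the edges with their weights in an arbitrary order. Theorem. For each $i_0\in\{0,1\}$ there are a program and a constant $C$, both independent of the input, such that for all $h,k,(\alpha_j)_j,\gamma,G,G'$ as above the program halts with output exactly $K(G,G')$.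 With $m=|E(G)|+|E(G')|$ and $n=|V(G)|+|V(G')|$, its number of steps is at most $C\,(h+1)\,k\,(n+m+1)$; and it is at most $C\,h\,k\,m$, that is $O(hkm)$, whenever $h\ge 1$, $m\ge 1$ and neither $G$ nor $G'$ has isolated vertices. -/

import Mathlib

namespace WLFilt

/-! ## Graphs, filtrations and Weisfeiler-Lehman labels -/

/-- A finite undirected graph on the vertices `0, …, n - 1` with discrete vertex labels (letters of
an alphabet, coded by natural numbers) and nonnegative real edge weights. -/
structure WGraph where
  n : ℕ
  graph : SimpleGraph (Fin n)
  label : Fin n → ℕ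
  weight : Sym2 (Fin n) → ℝ
  weight_nonneg : ∀ e ∈ graph.edgeSet, 0 ≤ weight e

/-- The number of edges. -/
noncomputable def WGraph.numEdges (G : WGraph) : ℕ := G.graph.edgeSet.ncard

/-- No vertex is isolated. -/
def WGraph.NoIsolated (G : WGraph) : Prop := ∀ v, ∃ u, G.graph.Adj v u

/-- Threshold values `α₁ ≥ α₂ ≥ … ≥ α_k = 0` (with `k ≥ 1`); position `j : Fin k` holds `α_{j+1}`. -/
structure Thresholds (k : ℕ) where
  val : Fin k → ℝ
  pos : 0 < k
  anti : Antitone val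
  last : val ⟨k - 1, Nat.sub_lt pos Nat.one_pos⟩ = 0

/-- The filtration graph: all vertices, and the edges of weight at least `a`. -/
def WGraph.filtrationGraph (G : WGraph) (a : ℝ) : SimpleGraph (Fin G.n) where
  Adj u v := G.graph.Adj u v ∧ a ≤ G.weight s(u, v)
  symm := ⟨fun u v h => ⟨h.1.symm, by rw [Sym2.eq_swap]; exact h.2⟩⟩
  loopless := ⟨fun v h => G.graph.loopless.irrefl v h.1⟩

/-- The alphabets `Σ_i`.  The perfect hash function is taken to be the identity, so that a letter of
`Σ_{i+1}` is the pair formed by a letter of `Σ_i` and a multiset of letters of `Σ_i`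
(sorting the list of the neighbours' labels serves to represent a multiset). -/
def WLAlphabet : ℕ → Type
  | 0 => ℕ
  | i + 1 => WLAlphabet i × Multiset (WLAlphabet i)

open Classical in
/-- The label of a vertex after `i` rounds of Weisfeiler-Lehman relabelling of the graph `H`
with initial vertex labels `l`. -/
noncomputable def wlLabel {n : ℕ} (H : SimpleGraph (Fin n)) (l : Fin n → ℕ) :
    (i : ℕ) → Fin n → WLAlphabet i
  | 0 => l
  | i + 1 => fun v =>
      (wlLabel H l i v, (Finset.univ.filter (fun u => H.Adj v u)).val.map (wlLabel H l i))

/-- A Weisfeiler-Lehman feature is a letter of one of the alphabets `Σ_i`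
(alphabets of different rounds are disjoint). -/
abbrev WLFeature : Type := Σ i : ℕ, WLAlphabet i

/-- `Σ_{i₀} ∪ … ∪ Σ_h`. -/
def wlFeatures (i₀ h : ℕ) : Set WLFeature := {f | i₀ ≤ f.1 ∧ f.1 ≤ h}

open Classical in
/-- The filtration histogram of a feature: its `j`-th entry is the number of vertices that carry the
label `f` in the `j`-th filtration graph. -/
noncomputable def wlHistogram {k : ℕ} (α : Thresholds k) (G : WGraph) (f : WLFeature) :
    Fin k → ℝ :=
  fun j => ((Finset.univ.filter
    (fun v => wlLabel (G.filtrationGraph (α.val j)) G.label f.1 v = f.2)).card : ℝ)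

/-! ## Wasserstein distance and filtration kernel -/

/-- The `ℓ¹` norm. -/
def norm1 {k : ℕ} (x : Fin k → ℝ) : ℝ := ∑ j, |x j|

/-- The mass-normalized histogram. -/
noncomputable def normalize {k : ℕ} (x : Fin k → ℝ) : Fin k → ℝ := fun j => x j / norm1 x

/-- Nonnegative transport plans with marginals `x` and `y`. -/
def transportPlans {k : ℕ} (x y : Fin k → ℝ) : Set (Fin k → Fin k → ℝ) :=
  {T | (∀ i j, 0 ≤ T i j) ∧ (∀ i, ∑ j, T i j = x i) ∧ (∀ j, ∑ i, T i j = y j)}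

/-- The 1-Wasserstein distance of two histograms, for the ground distance `|a i - a j|`:
the least cost of a transport plan. -/
noncomputable def wasserstein {k : ℕ} (a : Fin k → ℝ) (x y : Fin k → ℝ) : ℝ :=
  sInf ((fun T : Fin k → Fin k → ℝ => ∑ i, ∑ j, T i j * |a i - a j|) '' transportPlans x y)

/-- The base kernel of two (not yet normalized) filtration histograms.  It is meaningful when both
have nonzero mass; otherwise it enters the filtration kernel with weight zero. -/
noncomputable def baseKernel {k : ℕ} (a : Fin k → ℝ) (γ : ℝ) (x y : Fin k → ℝ) : ℝ :=
  Real.exp (-γ * wasserstein a (normalize x) (normalize y))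

/-- The filtration kernel over a set `S` of features, in terms of the histograms of both graphs. -/
noncomputable def filtrationKernel {F : Type} {k : ℕ} (a : Fin k → ℝ) (γ : ℝ) (S : Set F)
    (φ φ' : F → Fin k → ℝ) : ℝ :=
  ∑ᶠ f ∈ S, baseKernel a γ (φ f) (φ' f) * norm1 (φ f) * norm1 (φ' f)

/-- The Weisfeiler-Lehman filtration kernel. -/
noncomputable def wlKernel (i₀ h : ℕ) {k : ℕ} (α : Thresholds k) (γ : ℝ) (G G' : WGraph) : ℝ :=
  filtrationKernel α.val γ (wlFeatures i₀ h) (wlHistogram α G) (wlHistogram α G')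

/-- Only finitely many features contribute, so the sum that defines the kernel is a genuine one. -/
theorem wlKernel_support_finite (i₀ h : ℕ) {k : ℕ} (α : Thresholds k) (G : WGraph) :
    {f | f ∈ wlFeatures i₀ h ∧ norm1 (wlHistogram α G f) ≠ 0}.Finite := by
  have hfin : (Set.range (fun q : Fin (h + 1) × Fin k × Fin G.n =>
      (⟨q.1, wlLabel (G.filtrationGraph (α.val q.2.1)) G.label q.1 q.2.2⟩ : WLFeature))).Finite :=
    Set.finite_range _
  refine hfin.subset ?_
  rintro ⟨i, l⟩ ⟨⟨_, hi⟩, hne⟩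
  obtain ⟨j, _, hj⟩ := Finset.exists_ne_zero_of_sum_ne_zero hne
  rw [abs_ne_zero] at hj
  obtain ⟨v, hv⟩ := Finset.card_ne_zero.mp (Nat.cast_ne_zero.mp hj)
  exact ⟨(⟨i, Nat.lt_succ_of_le hi⟩, j, v), by
    simp only [Finset.mem_filter] at hv
    simp only [hv.2]⟩

/-! ## The machine model: a unit-cost real RAM

A program uses a fixed finite number of arrays of natural numbers and of real numbers.  Indices may
be computed (indirect addressing).  On natural numbers the machine can add, subtract and compare;
on real numbers it can add, subtract, multiply, divide, exponentiate and compare.  Each operation,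
each memory access, each constant and each test costs one step. -/

/-- The memory: cell `i` of array `a` of natural, respectively real, numbers. -/
@[ext] structure Store where
  nat : ℕ → ℕ → ℕ
  real : ℕ → ℕ → ℝ

/-- Write to a cell of an array of natural numbers. -/
def Store.setNat (s : Store) (a i x : ℕ) : Store :=
  { s with nat := Function.update s.nat a (Function.update (s.nat a) i x) }

/-- Write to a cell of an array of real numbers. -/
noncomputable def Store.setReal (s : Store) (a i : ℕ) (x : ℝ) : Store :=
  { s with real := Function.update s.real a (Function.update (s.real a) i x) }

inductive NatExpr : Type
  | const (c : ℕ)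
  | get (a : ℕ) (i : NatExpr)
  | add (e₁ e₂ : NatExpr)
  | sub (e₁ e₂ : NatExpr)

def NatExpr.eval (s : Store) : NatExpr → ℕ
  | .const c => c
  | .get a i => s.nat a (i.eval s)
  | .add e₁ e₂ => e₁.eval s + e₂.eval s
  | .sub e₁ e₂ => e₁.eval s - e₂.eval s

def NatExpr.cost : NatExpr → ℕ
  | .const _ => 1
  | .get _ i => i.cost + 1
  | .add e₁ e₂ => e₁.cost + e₂.cost + 1
  | .sub e₁ e₂ => e₁.cost + e₂.cost + 1

inductive RealExpr : Type
  | const (c : ℕ)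
  | get (a : ℕ) (i : NatExpr)
  | add (e₁ e₂ : RealExpr)
  | sub (e₁ e₂ : RealExpr)
  | mul (e₁ e₂ : RealExpr)
  | div (e₁ e₂ : RealExpr)
  | exp (e : RealExpr)

noncomputable def RealExpr.eval (s : Store) : RealExpr → ℝ
  | .const c => c
  | .get a i => s.real a (i.eval s)
  | .add e₁ e₂ => e₁.eval s + e₂.eval s
  | .sub e₁ e₂ => e₁.eval s - e₂.eval s
  | .mul e₁ e₂ => e₁.eval s * e₂.eval s
  | .div e₁ e₂ => e₁.eval s / e₂.eval s
  | .exp e => Real.exp (e.eval s)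

def RealExpr.cost : RealExpr → ℕ
  | .const _ => 1
  | .get _ i => i.cost + 1
  | .add e₁ e₂ => e₁.cost + e₂.cost + 1
  | .sub e₁ e₂ => e₁.cost + e₂.cost + 1
  | .mul e₁ e₂ => e₁.cost + e₂.cost + 1
  | .div e₁ e₂ => e₁.cost + e₂.cost + 1
  | .exp e => e.cost + 1

inductive Test : Type
  | natEq (e₁ e₂ : NatExpr)
  | natLt (e₁ e₂ : NatExpr)
  | realLe (e₁ e₂ : RealExpr)

def Test.Holds (s : Store) : Test → Prop
  | .natEq e₁ e₂ => e₁.eval s = e₂.eval s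
  | .natLt e₁ e₂ => e₁.eval s < e₂.eval s
  | .realLe e₁ e₂ => e₁.eval s ≤ e₂.eval s

def Test.cost : Test → ℕ
  | .natEq e₁ e₂ => e₁.cost + e₂.cost + 1
  | .natLt e₁ e₂ => e₁.cost + e₂.cost + 1
  | .realLe e₁ e₂ => e₁.cost + e₂.cost + 1

/-- Programs; they are finite objects and do not depend on any input. -/
inductive Prog : Type
  | nop
  | setNat (a : ℕ) (i e : NatExpr)
  | setReal (a : ℕ) (i : NatExpr) (e : RealExpr)
  | seq (p q : Prog)
  | cond (b : Test) (p q : Prog)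
  | loop (b : Test) (p : Prog)

/-- `Exec p s s' t`: started in memory `s`, the program `p` halts in memory `s'` after
exactly `t` steps. -/
inductive Exec : Prog → Store → Store → ℕ → Prop
  | nop (s : Store) : Exec .nop s s 1
  | setNat (s : Store) (a : ℕ) (i e : NatExpr) :
      Exec (.setNat a i e) s (s.setNat a (i.eval s) (e.eval s)) (i.cost + e.cost + 1)
  | setReal (s : Store) (a : ℕ) (i : NatExpr) (e : RealExpr) :
      Exec (.setReal a i e) s (s.setReal a (i.eval s) (e.eval s)) (i.cost + e.cost + 1)
  | seq {p q : Prog} {s s' s'' : Store} {t t' : ℕ} :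
      Exec p s s' t → Exec q s' s'' t' → Exec (.seq p q) s s'' (t + t')
  | condTrue {b : Test} {p q : Prog} {s s' : Store} {t : ℕ} :
      b.Holds s → Exec p s s' t → Exec (.cond b p q) s s' (b.cost + t)
  | condFalse {b : Test} {p q : Prog} {s s' : Store} {t : ℕ} :
      ¬ b.Holds s → Exec q s s' t → Exec (.cond b p q) s s' (b.cost + t)
  | loopTrue {b : Test} {p : Prog} {s s' s'' : Store} {t t' : ℕ} :
      b.Holds s → Exec p s s' t → Exec (.loop b p) s' s'' t' →
      Exec (.loop b p) s s'' (b.cost + t + t')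
  | loopFalse {b : Test} {p : Prog} {s : Store} :
      ¬ b.Holds s → Exec (.loop b p) s s b.cost

/-- The machine is deterministic: a halting run has one result and one running time. -/
theorem Exec.deterministic {p : Prog} {s s₁ s₂ : Store} {t₁ t₂ : ℕ}
    (h₁ : Exec p s s₁ t₁) (h₂ : Exec p s s₂ t₂) : s₁ = s₂ ∧ t₁ = t₂ := by
  induction h₁ generalizing s₂ t₂ with
  | nop => cases h₂; exact ⟨rfl, rfl⟩
  | setNat => cases h₂; exact ⟨rfl, rfl⟩
  | setReal => cases h₂; exact ⟨rfl, rfl⟩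
  | seq _ _ ih ih' =>
    cases h₂ with
    | seq a b =>
      obtain ⟨rfl, rfl⟩ := ih a
      obtain ⟨rfl, rfl⟩ := ih' b
      exact ⟨rfl, rfl⟩
  | condTrue hb _ ih =>
    cases h₂ with
    | condTrue _ a => obtain ⟨rfl, rfl⟩ := ih a; exact ⟨rfl, rfl⟩
    | condFalse hn _ => exact absurd hb hn
  | condFalse hb _ ih =>
    cases h₂ with
    | condTrue hn _ => exact absurd hn hb
    | condFalse _ a => obtain ⟨rfl, rfl⟩ := ih a; exact ⟨rfl, rfl⟩
  | loopTrue hb _ _ ih ih' =>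
    cases h₂ with
    | loopTrue _ a b =>
      obtain ⟨rfl, rfl⟩ := ih a
      obtain ⟨rfl, rfl⟩ := ih' b
      exact ⟨rfl, rfl⟩
    | loopFalse hn => exact absurd hb hn
  | loopFalse hb =>
    cases h₂ with
    | loopTrue hn _ _ => exact absurd hn hb
    | loopFalse _ => exact ⟨rfl, rfl⟩

/-! ## Input and output -/

/-- `L` lists every edge of `G` exactly once, in any order and any orientation. -/
def IsEdgeList (G : WGraph) (L : List (Fin G.n × Fin G.n)) : Prop :=
  (L.map fun e => s(e.1, e.2)).Nodup ∧
    ∀ e, e ∈ L.map (fun e => s(e.1, e.2)) ↔ e ∈ G.graph.edgeSet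

/-- The vertex labels of `G` as an array. -/
def labelArray (G : WGraph) (i : ℕ) : ℕ := if hi : i < G.n then G.label ⟨i, hi⟩ else 0

/-- The first endpoints of the listed edges as an array. -/
def sourceArray (G : WGraph) (L : List (Fin G.n × Fin G.n)) (i : ℕ) : ℕ :=
  L[i]?.elim 0 fun e => (e.1 : ℕ)

/-- The second endpoints of the listed edges as an array. -/
def targetArray (G : WGraph) (L : List (Fin G.n × Fin G.n)) (i : ℕ) : ℕ :=
  L[i]?.elim 0 fun e => (e.2 : ℕ)

/-- The weights of the listed edges as an array. -/
noncomputable def weightArray (G : WGraph) (L : List (Fin G.n × Fin G.n)) (i : ℕ) : ℝ :=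
  L[i]?.elim 0 fun e => G.weight s(e.1, e.2)

/-- The memory at the start: the sizes and parameters, both graphs (given by labels, edge lists and
edge weights), and the values `α₁, …, α_k`; all other cells hold zero. -/
noncomputable def inputStore (h : ℕ) {k : ℕ} (α : Thresholds k) (γ : ℝ)
    (G : WGraph) (L : List (Fin G.n × Fin G.n))
    (G' : WGraph) (L' : List (Fin G'.n × Fin G'.n)) : Store where
  nat := fun a i => match a with
    | 0 => match i with
      | 0 => h
      | 1 => k
      | 2 => G.n
      | 3 => L.length
      | 4 => G'.n
      | 5 => L'.length
      | _ => 0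
    | 1 => labelArray G i
    | 2 => sourceArray G L i
    | 3 => targetArray G L i
    | 4 => labelArray G' i
    | 5 => sourceArray G' L' i
    | 6 => targetArray G' L' i
    | _ => 0
  real := fun a i => match a with
    | 0 => match i with
      | 0 => γ
      | _ => 0
    | 1 => if hi : i < k then α.val ⟨i, hi⟩ else 0
    | 2 => weightArray G L i
    | 3 => weightArray G' L' i
    | _ => 0

/-- The result of a run is read off cell `0` of the real array `4`. -/
def Store.output (s : Store) : ℝ := s.real 4 0

end WLFilt

namespace WLFilt

/-! ## Reasoning about programs -/

/-! On a line the transport problem has a closed form. If the positions `a` are nonincreasing and X,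
Y are the cumulated masses of two distributions of equal total mass, the distance is the sum over
the gaps of |X_t - Y_t| (a_t - a_{t+1}) (`wasserstein_eq`). Every plan moves at least |X_t - Y_t|
across gap t, and the monotone coupling, whose cumulated mass is min(X_p, Y_q), attains all these
bounds at once. So the distances for all features can be accumulated in a single sweep through the
thresholds that touches a feature only at the vertices carrying it (`dist_spec`).

The filtration graphs of both inputs are laid out as one graph, copy by copy in the order of the
thresholds, with N = k n vertices and M ≤ k m edges. The class of a label in this graph records both
histograms of the feature. Then h + 1 rounds are performed, each in O(N + M) steps (`round_spec`),
which gives the bound (h + 1) k (n + m + 1). Without isolated vertices n ≤ 2m, and the second bound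
follows.

A round is linear because no sorting is needed. A vertex carries a natural number as code, and the
code serves as an address in a dictionary that yields a small identifier (`relabel_spec`). The next
code is the own identifier times 2^N plus a sum of powers of two over the neighbours. An identifier
carried by b vertices receives a field of b bits; its multiplicity among the neighbours of a vertex
is at most b < 2^b, and all fields together occupy exactly N bits. Hence this code determines the
identifier and the multiset of the neighbours' identifiers (`code_eq_iff`).

Correctness rests on the invariant that codes agree exactly where Weisfeiler-Lehman labels agree
(`RoundState`), on the identification of the labels of the large graph with those of the filtration
graphs (`FlatLayout.arrayLabel_eq`), and on the identification of the contribution of a class with a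
term of the kernel (`FlatLayout.classTerm_eq`). -/

@[simp] theorem Store.setNat_nat (s : Store) (a i x b j : ℕ) :
    (s.setNat a i x).nat b j = if b = a ∧ j = i then x else s.nat b j := by
  by_cases hb : b = a
  · subst hb
    by_cases hj : j = i <;> simp [Store.setNat, hj]
  · simp [Store.setNat, hb]

@[simp] theorem Store.setNat_real (s : Store) (a i x : ℕ) : (s.setNat a i x).real = s.real := rfl

@[simp] theorem Store.setReal_nat (s : Store) (a i : ℕ) (x : ℝ) : (s.setReal a i x).nat = s.nat :=
  rfl

@[simp] theorem Store.setReal_real (s : Store) (a i : ℕ) (x : ℝ) (b j : ℕ) :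
    (s.setReal a i x).real b j = if b = a ∧ j = i then x else s.real b j := by
  by_cases hb : b = a
  · subst hb
    by_cases hj : j = i <;> simp [Store.setReal, hj]
  · simp [Store.setReal, hb]

/-- The arrays of natural numbers that a program may write to. -/
def Prog.natWrites : Prog → List ℕ
  | .nop => []
  | .setNat a _ _ => [a]
  | .setReal _ _ _ => []
  | .seq p q => p.natWrites ++ q.natWrites
  | .cond _ p q => p.natWrites ++ q.natWrites
  | .loop _ p => p.natWrites

/-- The arrays of real numbers that a program may write to. -/
def Prog.realWrites : Prog → List ℕ
  | .nop => []
  | .setNat _ _ _ => []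
  | .setReal a _ _ => [a]
  | .seq p q => p.realWrites ++ q.realWrites
  | .cond _ p q => p.realWrites ++ q.realWrites
  | .loop _ p => p.realWrites

/-- Two memories agree outside the listed arrays. -/
def Store.AgreeOff (W R : List ℕ) (s s' : Store) : Prop :=
  (∀ a, a ∉ W → s'.nat a = s.nat a) ∧ ∀ a, a ∉ R → s'.real a = s.real a

theorem Store.AgreeOff.refl (W R : List ℕ) (s : Store) : s.AgreeOff W R s :=
  ⟨fun _ _ => rfl, fun _ _ => rfl⟩

theorem Store.AgreeOff.trans {W R : List ℕ} {s s' s'' : Store} (h : s.AgreeOff W R s')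
    (h' : s'.AgreeOff W R s'') : s.AgreeOff W R s'' :=
  ⟨fun a ha => (h'.1 a ha).trans (h.1 a ha), fun a ha => (h'.2 a ha).trans (h.2 a ha)⟩

theorem Store.AgreeOff.mono {W R W' R' : List ℕ} {s s' : Store} (h : s.AgreeOff W R s')
    (hW : W ⊆ W') (hR : R ⊆ R') : s.AgreeOff W' R' s' :=
  ⟨fun a ha => h.1 a fun hm => ha (hW hm), fun a ha => h.2 a fun hm => ha (hR hm)⟩

theorem Store.agreeOff_setNat (s : Store) {W : List ℕ} (R : List ℕ) {a : ℕ} (ha : a ∈ W)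
    (i x : ℕ) : s.AgreeOff W R (s.setNat a i x) :=
  ⟨fun b hb => by
    have : b ≠ a := fun h => hb (h ▸ ha)
    simp [Store.setNat, this], fun _ _ => rfl⟩

theorem Store.agreeOff_setReal (s : Store) (W : List ℕ) {R : List ℕ} {a : ℕ} (ha : a ∈ R)
    (i : ℕ) (x : ℝ) : s.AgreeOff W R (s.setReal a i x) :=
  ⟨fun _ _ => rfl, fun b hb => by
    have : b ≠ a := fun h => hb (h ▸ ha)
    simp [Store.setReal, this]⟩

/-- The lists of written arrays are read off the syntax, so that for a concrete program the claim
that an array is untouched becomes non-membership in an explicit list, which `decide` settles. -/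
theorem Exec.agreeOff {p : Prog} {s s' : Store} {t : ℕ} (h : Exec p s s' t) :
    s.AgreeOff p.natWrites p.realWrites s' := by
  induction h with
  | nop s => exact Store.AgreeOff.refl _ _ _
  | setNat s a i e => exact s.agreeOff_setNat _ (by simp [Prog.natWrites]) _ _
  | setReal s a i e => exact s.agreeOff_setReal _ (by simp [Prog.realWrites]) _ _
  | seq _ _ ih ih' =>
    exact (ih.mono (by simp [Prog.natWrites]) (by simp [Prog.realWrites])).trans
      (ih'.mono (by simp [Prog.natWrites]) (by simp [Prog.realWrites]))
  | condTrue _ _ ih => exact ih.mono (by simp [Prog.natWrites]) (by simp [Prog.realWrites])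
  | condFalse _ _ ih => exact ih.mono (by simp [Prog.natWrites]) (by simp [Prog.realWrites])
  | loopTrue _ _ _ ih ih' => exact Store.AgreeOff.trans ih ih'
  | loopFalse _ => exact Store.AgreeOff.refl _ _ _

/-! ### Time-bounded correctness, with rules for composition and loops -/

/-- Started in memory `s`, the program halts within `T` steps in a memory that satisfies `Q`. -/
def Prog.Achieves (p : Prog) (s : Store) (T : ℕ) (Q : Store → Prop) : Prop :=
  ∃ s' t, Exec p s s' t ∧ t ≤ T ∧ Q s'

theorem Prog.Achieves.mono {p : Prog} {s : Store} {T T' : ℕ} {Q Q' : Store → Prop}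
    (h : p.Achieves s T Q) (hT : T ≤ T')
    (hQ : ∀ s', s.AgreeOff p.natWrites p.realWrites s' → Q s' → Q' s') : p.Achieves s T' Q' := by
  obtain ⟨s', t, hE, ht, hs⟩ := h
  exact ⟨s', t, hE, ht.trans hT, hQ s' hE.agreeOff hs⟩

theorem Prog.Achieves.seq {p q : Prog} {s : Store} {T T' : ℕ} {Q Q' : Store → Prop}
    (h : p.Achieves s T Q)
    (h' : ∀ s', s.AgreeOff p.natWrites p.realWrites s' → Q s' → q.Achieves s' T' Q') :
    (Prog.seq p q).Achieves s (T + T') Q' := by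
  obtain ⟨s', t, hE, ht, hs⟩ := h
  obtain ⟨s'', t', hE', ht', hs'⟩ := h' s' hE.agreeOff hs
  exact ⟨s'', t + t', .seq hE hE', add_le_add ht ht', hs'⟩

theorem Prog.Achieves.cond {b : Test} {p q : Prog} {s : Store} {T : ℕ} {Q : Store → Prop}
    (h : b.Holds s → p.Achieves s T Q) (h' : ¬ b.Holds s → q.Achieves s T Q) :
    (Prog.cond b p q).Achieves s (b.cost + T) Q := by
  by_cases hb : b.Holds s
  · obtain ⟨s', t, hE, ht, hs⟩ := h hb
    exact ⟨s', _, .condTrue hb hE, Nat.add_le_add_left ht _, hs⟩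
  · obtain ⟨s', t, hE, ht, hs⟩ := h' hb
    exact ⟨s', _, .condFalse hb hE, Nat.add_le_add_left ht _, hs⟩

/-- Programs without loops. -/
def Prog.loopFree : Prog → Bool
  | .nop => true
  | .setNat _ _ _ => true
  | .setReal _ _ _ => true
  | .seq p q => p.loopFree && q.loopFree
  | .cond _ p q => p.loopFree && q.loopFree
  | .loop _ _ => false

open Classical in
/-- The effect of a loop-free program. -/
noncomputable def Prog.run : Prog → Store → Store
  | .nop, s => s
  | .setNat a i e, s => s.setNat a (i.eval s) (e.eval s)
  | .setReal a i e, s => s.setReal a (i.eval s) (e.eval s)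
  | .seq p q, s => q.run (p.run s)
  | .cond b p q, s => if b.Holds s then p.run s else q.run s
  | .loop _ _, s => s

/-- A bound for the running time of a loop-free program. -/
def Prog.maxCost : Prog → ℕ
  | .nop => 1
  | .setNat _ i e => i.cost + e.cost + 1
  | .setReal _ i e => i.cost + e.cost + 1
  | .seq p q => p.maxCost + q.maxCost
  | .cond b p q => b.cost + max p.maxCost q.maxCost
  | .loop _ _ => 0

/-- Almost all loop bodies below are loop-free. Their effect is then a function that `simp` can
evaluate and their cost a numeral that `decide` can bound; invariants are needed for loops only. -/
theorem Prog.exec_run {p : Prog} (hp : p.loopFree = true) (s : Store) :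
    ∃ t ≤ p.maxCost, Exec p s (p.run s) t := by
  induction p generalizing s with
  | nop => exact ⟨1, le_rfl, .nop s⟩
  | setNat a i e => exact ⟨_, le_rfl, .setNat s a i e⟩
  | setReal a i e => exact ⟨_, le_rfl, .setReal s a i e⟩
  | seq p q ihp ihq =>
    simp only [Prog.loopFree, Bool.and_eq_true] at hp
    obtain ⟨t, ht, hE⟩ := ihp hp.1 s
    obtain ⟨t', ht', hE'⟩ := ihq hp.2 (p.run s)
    exact ⟨t + t', add_le_add ht ht', .seq hE hE'⟩
  | cond b p q ihp ihq =>
    simp only [Prog.loopFree, Bool.and_eq_true] at hp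
    by_cases hb : b.Holds s
    · obtain ⟨t, ht, hE⟩ := ihp hp.1 s
      refine ⟨b.cost + t, Nat.add_le_add_left (ht.trans (le_max_left _ _)) _, ?_⟩
      rw [Prog.run, if_pos hb]
      exact .condTrue hb hE
    · obtain ⟨t, ht, hE⟩ := ihq hp.2 s
      refine ⟨b.cost + t, Nat.add_le_add_left (ht.trans (le_max_right _ _)) _, ?_⟩
      rw [Prog.run, if_neg hb]
      exact .condFalse hb hE
  | loop b p _ => simp [Prog.loopFree] at hp

theorem Prog.achieves_of_run {p : Prog} (hp : p.loopFree = true) {s : Store} {T : ℕ}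
    (hT : p.maxCost ≤ T) {Q : Store → Prop} (hQ : Q (p.run s)) : p.Achieves s T Q := by
  obtain ⟨t, ht, hE⟩ := Prog.exec_run hp s
  exact ⟨_, t, hE, ht.trans hT, hQ⟩

/-- The number in cell `0` of an array. -/
abbrev NatExpr.var (a : ℕ) : NatExpr := .get a (.const 0)

/-- `for c = 0, …, b - 1 do p`, where `b` and `c` are kept in cells `0` of arrays. -/
def Prog.forLoop (c b : ℕ) (p : Prog) : Prog :=
  .seq (.setNat c (.const 0) (.const 0))
    (.loop (.natLt (.var c) (.var b))
      (.seq p (.setNat c (.const 0) (.add (.var c) (.const 1)))))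

/-- Induction on the number `d` of remaining iterations. The body writes neither the counter nor the
bound, so the test compares the true values. The overhead 11 per iteration is the test (5) and the
increment (6); the final 8 is the initialization (3) and the failing test (5). -/
theorem Prog.achieves_forLoop {c b : ℕ} {p : Prog} {s : Store} {n T : ℕ}
    (I : ℕ → Store → Prop) {Q : Store → Prop}
    (hc : c ∉ p.natWrites) (hb : b ∉ c :: p.natWrites) (hn : s.nat b 0 = n)
    (h0 : I 0 (s.setNat c 0 0))
    (hstep : ∀ i < n, ∀ s', s.AgreeOff (c :: p.natWrites) p.realWrites s' → s'.nat c 0 = i →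
      I i s' → p.Achieves s' T fun s'' => I (i + 1) (s''.setNat c 0 (i + 1)))
    (hQ : ∀ s', s.AgreeOff (c :: p.natWrites) p.realWrites s' → I n s' → Q s') :
    (Prog.forLoop c b p).Achieves s (n * (T + 11) + 8) Q := by
  have key : ∀ d i s', i + d = n → s.AgreeOff (c :: p.natWrites) p.realWrites s' →
      s'.nat c 0 = i → I i s' →
      (Prog.loop (.natLt (.var c) (.var b))
        (.seq p (.setNat c (.const 0) (.add (.var c) (.const 1))))).Achieves s'
        (d * (T + 11) + 5) Q := by
    intro d
    induction d with
    | zero =>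
      intro i s' hi hA hci hI
      have hbn : s'.nat b 0 = n := by rw [hA.1 b hb, hn]
      have hi' : i = n := by simpa using hi
      refine ⟨s', _, .loopFalse ?_, by simp [Test.cost, NatExpr.cost], hQ s' hA (hi' ▸ hI)⟩
      simp [Test.Holds, NatExpr.eval, hci, hbn, hi']
    | succ d ih =>
      intro i s' hi hA hci hI
      have hbn : s'.nat b 0 = n := by rw [hA.1 b hb, hn]
      obtain ⟨s₁, t₁, hE₁, ht₁, hI₁⟩ := hstep i (by omega) s' hA hci hI
      have hc₁ : s₁.nat c 0 = i := by rw [hE₁.agreeOff.1 c hc, hci]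
      have hA₁ : s.AgreeOff (c :: p.natWrites) p.realWrites (s₁.setNat c 0 (i + 1)) :=
        (hA.trans (hE₁.agreeOff.mono (List.subset_cons_self _ _) (List.Subset.refl _))).trans
          (Store.agreeOff_setNat _ _ (by simp) _ _)
      obtain ⟨s₂, t₂, hE₂, ht₂, hQ₂⟩ := ih (i + 1) _ (by omega) hA₁ (by simp) hI₁
      have hinc : Exec (.setNat c (.const 0) (.add (.var c) (.const 1))) s₁
          (s₁.setNat c 0 (i + 1)) 6 := by
        have := Exec.setNat s₁ c (.const 0) (.add (.var c) (.const 1))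
        simpa [NatExpr.eval, NatExpr.cost, hc₁] using this
      refine ⟨s₂, _, .loopTrue ?_ (.seq hE₁ hinc) hE₂, ?_, hQ₂⟩
      · simp [Test.Holds, NatExpr.eval, hci, hbn]; omega
      · simp only [Test.cost, NatExpr.cost]
        rw [Nat.succ_mul]
        omega
  have h := key n 0 (s.setNat c 0 0) (by simp) (Store.agreeOff_setNat _ _ (by simp) _ _)
    (by simp) h0
  obtain ⟨s', t, hE, ht, hs⟩ := h
  refine ⟨s', _, .seq (Exec.setNat s c (.const 0) (.const 0)) hE, ?_, hs⟩
  simp only [NatExpr.cost]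
  omega

theorem Prog.achieves_forLoop_of_run {c b : ℕ} {p : Prog} {s : Store} {n : ℕ}
    (I : ℕ → Store → Prop) {Q : Store → Prop} (hp : p.loopFree = true)
    (hc : c ∉ p.natWrites) (hb : b ∉ c :: p.natWrites) (hn : s.nat b 0 = n)
    (h0 : I 0 (s.setNat c 0 0))
    (hstep : ∀ i < n, ∀ s', s.AgreeOff (c :: p.natWrites) p.realWrites s' → s'.nat c 0 = i →
      I i s' → I (i + 1) ((p.run s').setNat c 0 (i + 1)))
    (hQ : ∀ s', s.AgreeOff (c :: p.natWrites) p.realWrites s' → I n s' → Q s') :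
    (Prog.forLoop c b p).Achieves s (n * (p.maxCost + 11) + 8) Q :=
  Prog.achieves_forLoop I hc hb hn h0
    (fun i hi s' hA hci hI => Prog.achieves_of_run hp le_rfl (hstep i hi s' hA hci hI)) hQ

open Finset

/-! ## The Wasserstein distance on a line -/

/-- The mass of the first `t` positions. -/
def cumul {k : ℕ} (x : Fin k → ℝ) (t : ℕ) : ℝ := ∑ i : Fin k, if (i : ℕ) < t then x i else 0

/-- A sequence on `Fin k`, continued by `0`. -/
noncomputable def extend {k : ℕ} (a : Fin k → ℝ) (t : ℕ) : ℝ := if h : t < k then a ⟨t, h⟩ else 0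

theorem extend_val {k : ℕ} (a : Fin k → ℝ) (i : Fin k) : extend a i = a i := by
  simp [extend]

theorem cumul_eq_sum_range {k : ℕ} (x : Fin k → ℝ) {t : ℕ} (ht : t ≤ k) :
    cumul x t = ∑ i ∈ range t, extend x i := by
  have h : cumul x t = ∑ i : Fin k, if (i : ℕ) < t then extend x i else 0 := by
    simp [cumul, extend_val]
  rw [h, ← Finset.sum_range (fun i => if i < t then extend x i else 0), ← Finset.sum_filter]
  congr 1
  ext i
  simp only [mem_filter, mem_range]
  omega

theorem cumul_succ {k : ℕ} (x : Fin k → ℝ) (i : Fin k) :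
    cumul x (i + 1) = cumul x i + x i := by
  rw [cumul_eq_sum_range x i.isLt, cumul_eq_sum_range x i.isLt.le, Finset.sum_range_succ,
    extend_val]

theorem cumul_zero {k : ℕ} (x : Fin k → ℝ) : cumul x 0 = 0 := by simp [cumul]

theorem cumul_self {k : ℕ} (x : Fin k → ℝ) : cumul x k = ∑ i, x i := by simp [cumul]

theorem cumul_nonneg {k : ℕ} {x : Fin k → ℝ} (hx : ∀ i, 0 ≤ x i) (t : ℕ) : 0 ≤ cumul x t :=
  Finset.sum_nonneg fun i _ => by split_ifs <;> simp [hx i]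

theorem cumul_le {k : ℕ} {x : Fin k → ℝ} (hx : ∀ i, 0 ≤ x i) (t : ℕ) : cumul x t ≤ ∑ i, x i :=
  Finset.sum_le_sum fun i _ => by split_ifs <;> simp [hx i]

theorem sub_eq_sum_gaps {k : ℕ} (a : Fin k → ℝ) {i j : Fin k} (hij : i ≤ j) :
    a i - a j = ∑ t ∈ range k, if (i : ℕ) ≤ t ∧ t < j then extend a t - extend a (t + 1) else 0 := by
  rw [← Finset.sum_filter]
  have : (range k).filter (fun t => (i : ℕ) ≤ t ∧ t < j) = Ico (i : ℕ) j := by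
    ext t
    simp only [mem_filter, mem_range, mem_Ico]
    omega
  rw [this, ← extend_val a i, ← extend_val a j]
  have := Finset.sum_Ico_sub (fun t => - extend a t) (show (i : ℕ) ≤ j from hij)
  rw [← sub_eq_zero]
  rw [show (∑ t ∈ Ico (i : ℕ) j, (extend a t - extend a (t + 1)))
    = ∑ t ∈ Ico (i : ℕ) j, (- extend a (t + 1) - - extend a t) from
    Finset.sum_congr rfl fun _ _ => by ring, this]
  ring

/-- Exactly one of the two positions lies among the first `t + 1`. -/
abbrev Separates {k : ℕ} (t : ℕ) (i j : Fin k) : Prop :=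
  ((i : ℕ) ≤ t ∧ t < j) ∨ ((j : ℕ) ≤ t ∧ t < i)

theorem abs_sub_eq_sum_gaps {k : ℕ} {a : Fin k → ℝ} (ha : Antitone a) (i j : Fin k) :
    |a i - a j| = ∑ t ∈ range k, if Separates t i j then extend a t - extend a (t + 1) else 0 := by
  rcases le_total i j with hij | hij
  · rw [abs_of_nonneg (sub_nonneg.2 (ha hij)), sub_eq_sum_gaps a hij]
    refine Finset.sum_congr rfl fun t _ => if_congr ?_ rfl rfl
    have : (i : ℕ) ≤ j := hij
    omega
  · rw [abs_sub_comm, abs_of_nonneg (sub_nonneg.2 (ha hij)), sub_eq_sum_gaps a hij]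
    refine Finset.sum_congr rfl fun t _ => if_congr ?_ rfl rfl
    have : (j : ℕ) ≤ i := hij
    omega

/-- The ground distance is the sum of the gaps between two positions. Exchanging the sums charges
each gap with the mass that crosses it. -/
theorem cost_eq_sum_gaps {k : ℕ} {a : Fin k → ℝ} (ha : Antitone a) (T : Fin k → Fin k → ℝ) :
    ∑ i, ∑ j, T i j * |a i - a j| = ∑ t ∈ range k,
      (∑ i, ∑ j, if Separates t i j then T i j else 0) * (extend a t - extend a (t + 1)) := by
  simp_rw [abs_sub_eq_sum_gaps ha, Finset.mul_sum, Finset.sum_mul]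
  rw [Finset.sum_comm (s := range k)]
  refine Finset.sum_congr rfl fun i _ => ?_
  rw [Finset.sum_comm (s := range k)]
  refine Finset.sum_congr rfl fun j _ => Finset.sum_congr rfl fun t _ => ?_
  split_ifs <;> ring

theorem cumul_fst {k : ℕ} {x y : Fin k → ℝ} {T : Fin k → Fin k → ℝ}
    (hT : T ∈ transportPlans x y) (t : ℕ) :
    cumul x t = ∑ i : Fin k, ∑ j, if (i : ℕ) < t then T i j else 0 :=
  Finset.sum_congr rfl fun i _ => by split_ifs <;> simp [hT.2.1 i]

theorem cumul_snd {k : ℕ} {x y : Fin k → ℝ} {T : Fin k → Fin k → ℝ}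
    (hT : T ∈ transportPlans x y) (t : ℕ) :
    cumul y t = ∑ i, ∑ j : Fin k, if (j : ℕ) < t then T i j else 0 := by
  rw [Finset.sum_comm]
  exact Finset.sum_congr rfl fun i _ => by split_ifs <;> simp [hT.2.2 i]

/-- If p and q are the indicators of `i ≤ t` and `j ≤ t`, the indicator of separation is p + q -
2pq. -/
theorem separated_mass {k : ℕ} {x y : Fin k → ℝ} {T : Fin k → Fin k → ℝ}
    (hT : T ∈ transportPlans x y) (t : ℕ) :
    (∑ i, ∑ j, if Separates t i j then T i j else 0) = cumul x (t + 1) + cumul y (t + 1)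
      - 2 * ∑ i : Fin k, ∑ j : Fin k, if (i : ℕ) < t + 1 ∧ (j : ℕ) < t + 1 then T i j else 0 := by
  rw [cumul_fst hT, cumul_snd hT]
  simp only [Finset.mul_sum, ← Finset.sum_add_distrib, ← Finset.sum_sub_distrib]
  refine Finset.sum_congr rfl fun i _ => Finset.sum_congr rfl fun j _ => ?_
  have hs : Separates t i j ↔ ¬((i : ℕ) < t + 1 ↔ (j : ℕ) < t + 1) := by omega
  by_cases h₁ : (i : ℕ) < t + 1 <;> by_cases h₂ : (j : ℕ) < t + 1 <;>
    simp only [hs, h₁, h₂, not_true, if_true, if_false, and_true, and_false, iff_true, iff_false,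
      not_false_iff] <;> ring

/-- In the difference of the cumulated masses the entries with both positions on the same side of
the gap cancel, and the others occur with a sign. -/
theorem abs_cumul_sub_le {k : ℕ} {x y : Fin k → ℝ} {T : Fin k → Fin k → ℝ}
    (hT : T ∈ transportPlans x y) (t : ℕ) :
    |cumul x (t + 1) - cumul y (t + 1)| ≤ ∑ i, ∑ j, if Separates t i j then T i j else 0 := by
  rw [cumul_fst hT, cumul_snd hT]
  simp only [← Finset.sum_sub_distrib]
  refine (Finset.abs_sum_le_sum_abs _ _).trans (Finset.sum_le_sum fun i _ => ?_)
  refine (Finset.abs_sum_le_sum_abs _ _).trans (Finset.sum_le_sum fun j _ => ?_)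
  have h := hT.1 i j
  have hs : Separates t i j ↔ ¬((i : ℕ) < t + 1 ↔ (j : ℕ) < t + 1) := by omega
  by_cases h₁ : (i : ℕ) < t + 1 <;> by_cases h₂ : (j : ℕ) < t + 1 <;>
    simp only [hs, h₁, h₂, not_true, if_true, if_false, iff_true, iff_false, not_false_iff,
      sub_zero, zero_sub, sub_self, abs_neg, abs_zero, abs_of_nonneg h, le_refl]

/-! ### The monotone coupling and its optimality -/

/-- The mass that the monotone coupling puts on the first `p` times the first `q` positions. -/
noncomputable def monotoneCumul {k : ℕ} (x y : Fin k → ℝ) (p q : ℕ) : ℝ :=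
  min (cumul x p) (cumul y q)

/-- The monotone coupling of two mass distributions on a line. -/
noncomputable def monotonePlan {k : ℕ} (x y : Fin k → ℝ) (p q : ℕ) : ℝ :=
  monotoneCumul x y (p + 1) (q + 1) - monotoneCumul x y p (q + 1)
    - (monotoneCumul x y (p + 1) q - monotoneCumul x y p q)

theorem sum_monotonePlan {k : ℕ} {x y : Fin k → ℝ} (hx : ∀ i, 0 ≤ x i) (p q : ℕ) :
    ∑ j ∈ range q, monotonePlan x y p j
      = monotoneCumul x y (p + 1) q - monotoneCumul x y p q := by
  unfold monotonePlan
  rw [Finset.sum_range_sub (fun j => monotoneCumul x y (p + 1) j - monotoneCumul x y p j)]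
  -- The boundary terms of the telescoping sum have the form `min (cumul x _) 0`, which is zero
  -- because cumulated masses are nonnegative.
  simp [monotoneCumul, cumul_zero, cumul_nonneg hx]

theorem sum_sum_monotonePlan {k : ℕ} {x y : Fin k → ℝ} (hx : ∀ i, 0 ≤ x i) (hy : ∀ i, 0 ≤ y i)
    (p q : ℕ) : ∑ i ∈ range p, ∑ j ∈ range q, monotonePlan x y i j = monotoneCumul x y p q := by
  simp only [sum_monotonePlan hx]
  rw [Finset.sum_range_sub (fun i => monotoneCumul x y i q)]
  simp [monotoneCumul, cumul_zero, cumul_nonneg hy]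

theorem monotonePlan_symm {k : ℕ} (x y : Fin k → ℝ) (p q : ℕ) :
    monotonePlan x y p q = monotonePlan y x q p := by
  simp only [monotonePlan, monotoneCumul, min_comm (cumul x _)]
  ring

/-- An entry is the length of the overlap of the intervals from `cumul x i` to `cumul x (i + 1)` and
from `cumul y j` to `cumul y (j + 1)`, hence nonnegative; the proof runs through the possible orders
of the end points. For the marginals the row sums telescope, and equal total mass makes the minimum
at the right end equal to `cumul x`. -/
theorem monotonePlan_mem {k : ℕ} {x y : Fin k → ℝ} (hx : ∀ i, 0 ≤ x i) (hy : ∀ i, 0 ≤ y i)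
    (hxy : ∑ i, x i = ∑ i, y i) :
    (fun i j : Fin k => monotonePlan x y i j) ∈ transportPlans x y := by
  have row : ∀ {x y : Fin k → ℝ}, (∀ i, 0 ≤ x i) → ∑ i, x i = ∑ i, y i → ∀ i : Fin k,
      ∑ j : Fin k, monotonePlan x y i j = x i := by
    intro x y hx hxy i
    rw [← Finset.sum_range (fun j => monotonePlan x y i j), sum_monotonePlan hx]
    unfold monotoneCumul
    rw [cumul_self, ← hxy, min_eq_left (cumul_le hx _), min_eq_left (cumul_le hx _), cumul_succ]
    ring
  refine ⟨fun i j => ?_, row hx hxy, fun j => ?_⟩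
  · have h₁ := hx i
    have h₂ := hy j
    simp only [monotonePlan, monotoneCumul, cumul_succ]
    rcases le_total (cumul x i + x i) (cumul y j + y j) with h₃ | h₃ <;>
    rcases le_total (cumul x i) (cumul y j + y j) with h₄ | h₄ <;>
    rcases le_total (cumul x i + x i) (cumul y j) with h₅ | h₅ <;>
    rcases le_total (cumul x i) (cumul y j) with h₆ | h₆ <;>
    simp only [min_eq_left, min_eq_right, h₃, h₄, h₅, h₆] <;> linarith
  · simp only [monotonePlan_symm x y]
    exact row hy hxy.symm j

/-- This is X + Y - 2 min(X, Y) = |X - Y|, so the coupling attains the bound of `abs_cumul_sub_le`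
at every gap simultaneously. -/
theorem separated_mass_monotonePlan {k : ℕ} {x y : Fin k → ℝ} (hx : ∀ i, 0 ≤ x i)
    (hy : ∀ i, 0 ≤ y i) (hxy : ∑ i, x i = ∑ i, y i) {t : ℕ} (ht : t < k) :
    (∑ i : Fin k, ∑ j : Fin k, if Separates t i j then monotonePlan x y i j else 0)
      = |cumul x (t + 1) - cumul y (t + 1)| := by
  rw [separated_mass (monotonePlan_mem hx hy hxy)]
  have h : (∑ i : Fin k, ∑ j : Fin k,
      if (i : ℕ) < t + 1 ∧ (j : ℕ) < t + 1 then monotonePlan x y i j else 0)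
      = min (cumul x (t + 1)) (cumul y (t + 1)) := by
    have hf : (range k).filter (· < t + 1) = range (t + 1) := by
      ext i; simp only [mem_filter, mem_range]; omega
    rw [← monotoneCumul, ← sum_sum_monotonePlan hx hy, ← Finset.sum_range (n := k)
      (fun i => ∑ j : Fin k, if i < t + 1 ∧ (j : ℕ) < t + 1 then monotonePlan x y i j else 0),
      ← hf, Finset.sum_filter]
    refine Finset.sum_congr rfl fun i _ => ?_
    rw [← Finset.sum_range (fun j => if i < t + 1 ∧ j < t + 1 then monotonePlan x y i j else 0)]
    split_ifs with hi
    · simp [hi, Finset.sum_filter]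
    · simp [hi]
  rw [h]
  rcases le_total (cumul x (t + 1)) (cumul y (t + 1)) with h' | h'
  · rw [min_eq_left h', abs_of_nonpos (by linarith)]; ring
  · rw [min_eq_right h', abs_of_nonneg (by linarith)]; ring

theorem extend_gap_nonneg {k : ℕ} {a : Fin k → ℝ} (ha : Antitone a) {t : ℕ} (ht : t + 1 < k) :
    0 ≤ extend a t - extend a (t + 1) := by
  rw [extend, extend, dif_pos ht, dif_pos (by omega), sub_nonneg]
  exact ha (Fin.mk_le_mk.2 (Nat.le_succ t))

/-- The monotone coupling gives a plan of this cost; in any other plan each gap is crossed by at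
least as much mass, and gaps are nonnegative. -/
theorem wasserstein_eq {k : ℕ} {a : Fin k → ℝ} (ha : Antitone a) {x y : Fin k → ℝ}
    (hx : ∀ i, 0 ≤ x i) (hy : ∀ i, 0 ≤ y i) (hxy : ∑ i, x i = ∑ i, y i) :
    wasserstein a x y = ∑ t ∈ range k,
      |cumul x (t + 1) - cumul y (t + 1)| * (extend a t - extend a (t + 1)) := by
  refine IsLeast.csInf_eq ⟨⟨_, monotonePlan_mem hx hy hxy, ?_⟩, ?_⟩
  · simp only
    rw [cost_eq_sum_gaps ha (fun i j : Fin k => monotonePlan x y i j)]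
    refine Finset.sum_congr rfl fun t ht => ?_
    rw [separated_mass_monotonePlan hx hy hxy (mem_range.1 ht)]
  · rintro _ ⟨T, hT, rfl⟩
    simp only
    rw [cost_eq_sum_gaps ha]
    refine Finset.sum_le_sum fun t ht => ?_
    have htk := mem_range.1 ht
    by_cases h : t + 1 < k
    · exact mul_le_mul_of_nonneg_right (abs_cumul_sub_le hT t) (extend_gap_nonneg ha h)
    -- The last gap runs to the artificial value `extend a k = 0` and may have either sign. No pair
    -- of positions is separated there, and the cumulated masses are the equal totals, so both sides
    -- vanish.
    · have h' : t + 1 = k := by omega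
      have hz : ∀ i j : Fin k, ¬ Separates t i j := fun i j => by
        have := i.isLt; have := j.isLt
        omega
      simp [hz, h', cumul_self, hxy]

/-! ## The algorithm

The `k` filtration graphs of both graphs are laid out as one graph, copy by copy.  A round replaces
the codes of the vertices by identifiers, by looking the codes up in an array that is addressed by
them; identifiers are never reused, so that no array has to be cleared.  The transport costs of all
identifiers are found in one pass over the vertices, and the code of the next round adds, over the
neighbours, weights that leave enough bits for the multiplicity of each identifier. -/

local notation "sizeG" => (10 : ℕ)
local notation "edgesG" => (11 : ℕ)
local notation "sizeH" => (12 : ℕ)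
local notation "edgesH" => (13 : ℕ)
local notation "copies" => (14 : ℕ)
local notation "levels" => (15 : ℕ)
local notation "vertexTotal" => (16 : ℕ)
local notation "edgeTotal" => (17 : ℕ)
local notation "offset" => (18 : ℕ)
local notation "sizeBoth" => (19 : ℕ)
local notation "edgesBoth" => (20 : ℕ)
local notation "lastOld" => (21 : ℕ)
local notation "lastUsed" => (22 : ℕ)
local notation "position" => (23 : ℕ)
local notation "multiple" => (24 : ℕ)
local notation "fresh" => (25 : ℕ)
local notation "ctr" => (30 : ℕ)
local notation "copyCtr" => (31 : ℕ)
local notation "levelCtr" => (32 : ℕ)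
local notation "codeArr" => (40 : ℕ)
local notation "sideArr" => (41 : ℕ)
local notation "sourceArr" => (42 : ℕ)
local notation "targetArr" => (43 : ℕ)
local notation "powerArr" => (44 : ℕ)
local notation "dictArr" => (45 : ℕ)
local notation "idArr" => (46 : ℕ)
local notation "countArr" => (47 : ℕ)
local notation "weightArr" => (48 : ℕ)
local notation "shiftArr" => (49 : ℕ)
-- Arrays of real numbers are numbered independently of those of natural numbers, so the repeated
-- numbers do not clash.
local notation "levelArr" => (10 : ℕ)
local notation "massArrG" => (11 : ℕ)
local notation "massArrH" => (12 : ℕ)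
local notation "distArr" => (13 : ℕ)
local notation "lastArr" => (14 : ℕ)
local notation "excessArr" => (15 : ℕ)

/-- Replace the code of a vertex by a fresh identifier, the same for equal codes. -/
def relabelBody : Prog :=
  .seq
    (.cond (.natLt (.var lastOld) (.get dictArr (.get codeArr (.var ctr)))) .nop
      (.seq (.setNat lastUsed (.const 0) (.add (.var lastUsed) (.const 1)))
        (.setNat dictArr (.get codeArr (.var ctr)) (.var lastUsed))))
    (.setNat idArr (.var ctr) (.get dictArr (.get codeArr (.var ctr))))

/-- A dictionary entry above `lastOld` was written in the current round; any smaller entry is stale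
and counts as absent, which is why nothing has to be cleared. Every new identifier exceeds all
entries, so the dictionary stays injective on its current entries, and this is the part of the
invariant that separates different codes. -/
theorem relabel_spec {s : Store} {N : ℕ} (hN : s.nat vertexTotal 0 = N)
    (hd : ∀ z, s.nat dictArr z ≤ s.nat lastUsed 0) (hb : s.nat lastOld 0 = s.nat lastUsed 0) :
    (Prog.forLoop ctr vertexTotal relabelBody).Achieves s (N * (relabelBody.maxCost + 11) + 8)
      fun t => (∀ z, t.nat dictArr z ≤ t.nat lastUsed 0) ∧
        s.nat lastUsed 0 ≤ t.nat lastUsed 0 ∧ t.nat lastUsed 0 ≤ s.nat lastUsed 0 + N ∧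
        (∀ x < N, s.nat lastUsed 0 < t.nat idArr x ∧ t.nat idArr x ≤ t.nat lastUsed 0) ∧
        ∀ x < N, ∀ y < N, t.nat idArr x = t.nat idArr y ↔ s.nat codeArr x = s.nat codeArr y := by
  refine Prog.achieves_forLoop_of_run (fun p t => (∀ z, t.nat dictArr z ≤ t.nat lastUsed 0) ∧
        s.nat lastUsed 0 ≤ t.nat lastUsed 0 ∧ t.nat lastUsed 0 ≤ s.nat lastUsed 0 + p ∧
        (∀ z z', s.nat lastUsed 0 < t.nat dictArr z → t.nat dictArr z = t.nat dictArr z' → z = z') ∧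
        ∀ x < p, s.nat lastUsed 0 < t.nat idArr x ∧ t.nat idArr x = t.nat dictArr (s.nat codeArr x))
    (by decide) (by decide) (by decide) hN ?_ ?_ ?_
  · simp only [Store.setNat_nat]
    refine ⟨by simpa using hd, by simp, by simp, fun z z' h => ?_, by simp⟩
    have := hd z
    simp at h
    omega
  · rintro i hi t hA hc ⟨h1, h2, h3, h4, h5⟩
    have hcode : t.nat codeArr = s.nat codeArr := hA.1 codeArr (by decide)
    have hold : t.nat lastOld = s.nat lastOld := hA.1 lastOld (by decide)
    by_cases h : s.nat lastUsed 0 < t.nat dictArr (s.nat codeArr i)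
    · simp [relabelBody, Prog.run, Test.Holds, NatExpr.eval, hc, hcode, hold, hb, h]
      refine ⟨h1, h2, by omega, h4, fun x hx => ?_⟩
      split_ifs with hxi
      · simp [hxi, h]
      · exact h5 x (by omega)
    · simp [relabelBody, Prog.run, Test.Holds, NatExpr.eval, hc, hcode, hold, hb, h]
      refine ⟨fun z => ?_, by omega, by omega, fun z z' => ?_, fun x hx => ?_⟩
      · split_ifs
        · exact le_rfl
        · exact (h1 z).trans (Nat.le_succ _)
      · have := h1 z; have := h1 z'
        split_ifs with hz hz'
        · intros; omega
        · intros; omega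
        · intros; omega
        · exact h4 z z'
      · by_cases hxi : x = i
        · simp [hxi]; omega
        · have h5' := h5 x (by omega)
          simp only [hxi, if_false]
          -- An earlier vertex with the same code would have left an entry above `lastOld`, contrary
          -- to `h`.
          rw [if_neg]
          · exact h5'
          · intro he
            rw [he] at h5'
            omega
  · rintro t hA ⟨h1, h2, h3, h4, h5⟩
    refine ⟨h1, h2, h3, fun x hx => ⟨(h5 x hx).1, (h5 x hx).2.trans_le (h1 _)⟩,
      fun x hx y hy => ?_⟩
    rw [(h5 x hx).2, (h5 y hy).2]
    exact ⟨fun h => h4 _ _ ((h5 x hx).2 ▸ (h5 x hx).1) h, fun h => by rw [h]⟩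

/-! ### Histograms of the identifiers -/

/-- Count the vertices with a given identifier. -/
def countBody : Prog :=
  .seq (.setNat countArr (.get idArr (.var ctr)) (.add (.get countArr (.get idArr (.var ctr))) (.const 1)))
    (.cond (.natEq (.get sideArr (.var ctr)) (.const 1))
      (.setReal massArrG (.get idArr (.var ctr))
        (.add (.get massArrG (.get idArr (.var ctr))) (.const 1)))
      (.setReal massArrH (.get idArr (.var ctr))
        (.add (.get massArrH (.get idArr (.var ctr))) (.const 1))))

theorem count_spec {s : Store} {N : ℕ} (hN : s.nat vertexTotal 0 = N) :
    (Prog.forLoop ctr vertexTotal countBody).Achieves s (N * (countBody.maxCost + 11) + 8)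
      fun t => (∀ c, t.nat countArr c = s.nat countArr c + #{x ∈ range N | s.nat idArr x = c}) ∧
        (∀ c, t.real massArrG c
          = s.real massArrG c + #{x ∈ range N | s.nat idArr x = c ∧ s.nat sideArr x = 1}) ∧
        ∀ c, t.real massArrH c
          = s.real massArrH c + #{x ∈ range N | s.nat idArr x = c ∧ s.nat sideArr x ≠ 1} := by
  refine Prog.achieves_forLoop_of_run (fun p t =>
        (∀ c, t.nat countArr c = s.nat countArr c + #{x ∈ range p | s.nat idArr x = c}) ∧
        (∀ c, t.real massArrG c
          = s.real massArrG c + #{x ∈ range p | s.nat idArr x = c ∧ s.nat sideArr x = 1}) ∧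
        ∀ c, t.real massArrH c
          = s.real massArrH c + #{x ∈ range p | s.nat idArr x = c ∧ s.nat sideArr x ≠ 1})
    (by decide) (by decide) (by decide) hN ?_ ?_ ?_
  · simp
  · rintro i hi t hA hc ⟨h1, h2, h3⟩
    have hident : t.nat idArr = s.nat idArr := hA.1 idArr (by decide)
    have hside : t.nat sideArr = s.nat sideArr := hA.1 sideArr (by decide)
    simp only [Finset.range_add_one, Finset.filter_insert]
    by_cases h : s.nat sideArr i = 1
    · simp [countBody, Prog.run, Test.Holds, NatExpr.eval, RealExpr.eval, hc, hident, hside, h, h1,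
        h2, h3]
      refine ⟨fun c => ?_, fun c => ?_⟩ <;> split_ifs <;> simp_all <;> ring
    · simp [countBody, Prog.run, Test.Holds, NatExpr.eval, RealExpr.eval, hc, hident, hside, h, h1,
        h2, h3]
      refine ⟨fun c => ?_, fun c => ?_⟩ <;> split_ifs <;> simp_all <;> ring
  · exact fun t _ h => h

/-! ### Transport costs of all identifiers in one sweep -/

/-- The number of vertices of the first graph in a set of vertices. -/
def massOne (S : ℕ → ℕ) (Q : Finset ℕ) : ℕ := #{x ∈ Q | S x = 1}

/-- The number of vertices of the second graph in a set of vertices. -/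
def massTwo (S : ℕ → ℕ) (Q : Finset ℕ) : ℕ := #{x ∈ Q | S x ≠ 1}

/-- The difference of the normalized masses that both graphs have among the first `p` vertices. -/
noncomputable def signedMass (S : ℕ → ℕ) (Q : Finset ℕ) (p : ℕ) : ℝ :=
  ∑ x ∈ range p, if x ∈ Q then
    if S x = 1 then (1 : ℝ) / massOne S Q else - ((1 : ℝ) / massTwo S Q) else 0

/-- The transport cost that arises among the first `p` vertices, if vertex `x` is at `A x`. -/
noncomputable def partialDist (S : ℕ → ℕ) (A : ℕ → ℝ) (Q : Finset ℕ) (p : ℕ) : ℝ :=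
  ∑ t ∈ range p, |signedMass S Q (t + 1)| * (A t - A (t + 1))

/-- The vertices with a given identifier. -/
abbrev idClass (s : Store) (N c : ℕ) : Finset ℕ := {x ∈ range N | s.nat idArr x = c}

/-- Update the transport cost for the identifier of a vertex. -/
def distBody : Prog :=
  .seq
    (.cond (.realLe (.const 0) (.get excessArr (.get idArr (.var ctr))))
      (.setReal distArr (.get idArr (.var ctr)) (.add (.get distArr (.get idArr (.var ctr)))
        (.mul (.get excessArr (.get idArr (.var ctr)))
          (.sub (.get lastArr (.get idArr (.var ctr))) (.get levelArr (.var ctr))))))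
      (.setReal distArr (.get idArr (.var ctr)) (.add (.get distArr (.get idArr (.var ctr)))
        (.mul (.sub (.const 0) (.get excessArr (.get idArr (.var ctr))))
          (.sub (.get lastArr (.get idArr (.var ctr))) (.get levelArr (.var ctr)))))))
    (.seq (.setReal lastArr (.get idArr (.var ctr)) (.get levelArr (.var ctr)))
      (.cond (.natEq (.get sideArr (.var ctr)) (.const 1))
        (.setReal excessArr (.get idArr (.var ctr)) (.add (.get excessArr (.get idArr (.var ctr)))
          (.div (.const 1) (.get massArrG (.get idArr (.var ctr))))))
        (.setReal excessArr (.get idArr (.var ctr)) (.sub (.get excessArr (.get idArr (.var ctr)))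
          (.div (.const 1) (.get massArrH (.get idArr (.var ctr))))))))

/-- The branch on the sign of the excess replaces the absolute value, which is not a machine
operation. -/
theorem distBody_run {s : Store} :
    (∀ a, (distBody.run s).nat a = s.nat a) ∧
    (∀ c, (distBody.run s).real distArr c = if c = s.nat idArr (s.nat ctr 0) then
      s.real distArr c + |s.real excessArr c| * (s.real lastArr c - s.real levelArr (s.nat ctr 0))
      else s.real distArr c) ∧
    (∀ c, (distBody.run s).real lastArr c = if c = s.nat idArr (s.nat ctr 0) then
      s.real levelArr (s.nat ctr 0) else s.real lastArr c) ∧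
    ∀ c, (distBody.run s).real excessArr c = if c = s.nat idArr (s.nat ctr 0) then
      s.real excessArr c + (if s.nat sideArr (s.nat ctr 0) = 1 then 1 / s.real massArrG c
        else - (1 / s.real massArrH c)) else s.real excessArr c := by
  by_cases h : 0 ≤ s.real excessArr (s.nat idArr (s.nat ctr 0)) <;>
  by_cases h' : s.nat sideArr (s.nat ctr 0) = 1 <;>
  simp [distBody, Prog.run, Test.Holds, NatExpr.eval, RealExpr.eval, h, h'] <;>
  refine ⟨fun c => ?_, fun c => ?_⟩ <;> split_ifs <;> simp_all [abs_of_nonneg, abs_of_neg] <;> ring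

/-- Payment is deferred: between two visits to a class its excess is constant and the level
differences telescope, so `distArr` plus |excess| times (last level - current level) is always the
cost so far. On the first visit the excess is zero, so the initial content of `lastArr` is
irrelevant. The clause on empty classes keeps identifiers not yet issued clean for later rounds. -/
theorem dist_spec {s : Store} {N b : ℕ} (hN : s.nat vertexTotal 0 = N)
    (hG : ∀ c, b < c → s.real massArrG c = massOne (s.nat sideArr) (idClass s N c))
    (hH : ∀ c, b < c → s.real massArrH c = massTwo (s.nat sideArr) (idClass s N c))
    (h0 : ∀ c, b < c → s.real distArr c = 0) (h0' : ∀ c, b < c → s.real excessArr c = 0) :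
    (Prog.forLoop ctr vertexTotal distBody).Achieves s (N * (distBody.maxCost + 11) + 8)
      fun t => ∀ c, b < c → (massOne (s.nat sideArr) (idClass s N c) ≠ 0 →
          massTwo (s.nat sideArr) (idClass s N c) ≠ 0 →
          t.real distArr c = partialDist (s.nat sideArr) (s.real levelArr) (idClass s N c) N) ∧
        (idClass s N c = ∅ → t.real distArr c = 0 ∧ t.real excessArr c = 0) := by
  refine Prog.achieves_forLoop_of_run (fun p t => ∀ c, b < c →
      t.real excessArr c = signedMass (s.nat sideArr) (idClass s N c) p ∧
      t.real distArr c + |t.real excessArr c| * (t.real lastArr c - s.real levelArr p)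
        = partialDist (s.nat sideArr) (s.real levelArr) (idClass s N c) p ∧
      (idClass s N c = ∅ → t.real distArr c = 0))
    (by decide) (by decide) (by decide) hN ?_ ?_ ?_
  · intro c hbc
    simp [h0 c hbc, h0' c hbc, signedMass, partialDist]
  · intro i hi t hA hc hI c hbc
    have hident : t.nat idArr = s.nat idArr := hA.1 idArr (by decide)
    have hside : t.nat sideArr = s.nat sideArr := hA.1 sideArr (by decide)
    have hlevel : t.real levelArr = s.real levelArr := hA.2 levelArr (by decide)
    have hmG : t.real massArrG = s.real massArrG := hA.2 massArrG (by decide)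
    have hmH : t.real massArrH = s.real massArrH := hA.2 massArrH (by decide)
    obtain ⟨h1, h2, h3⟩ := hI c hbc
    obtain ⟨-, r2, r3, r4⟩ := distBody_run (s := t)
    simp only [Store.setNat_real, r2, r3, r4, hc, hident, hside, hlevel, hmG, hmH]
    have hex : (if c = s.nat idArr i then t.real excessArr c + (if s.nat sideArr i = 1 then
        1 / s.real massArrG c else - (1 / s.real massArrH c)) else t.real excessArr c)
        = signedMass (s.nat sideArr) (idClass s N c) (i + 1) := by
      rw [signedMass, Finset.sum_range_succ, ← signedMass, ← h1, hG c hbc, hH c hbc]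
      simp only [Finset.mem_filter, Finset.mem_range, hi, true_and, eq_comm (a := c)]
      split_ifs <;> ring
    refine ⟨hex, ?_, fun he => ?_⟩
    · rw [hex, partialDist, Finset.sum_range_succ, ← partialDist, ← h2]
      split_ifs with hci
      · ring
      · rw [if_neg hci] at hex
        rw [← hex]; ring
    · rw [if_neg, h3 he]
      rintro rfl
      have : i ∈ idClass s N (s.nat idArr i) := by simp [hi]
      rw [he] at this
      simp at this
  · intro t hA hI c hbc
    obtain ⟨h1, h2, h3⟩ := hI c hbc
    have hsum : signedMass (s.nat sideArr) (idClass s N c) N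
        = (∑ x ∈ idClass s N c with s.nat sideArr x = 1,
            (1 : ℝ) / massOne (s.nat sideArr) (idClass s N c))
          + ∑ x ∈ idClass s N c with s.nat sideArr x ≠ 1,
            - ((1 : ℝ) / massTwo (s.nat sideArr) (idClass s N c)) := by
      rw [signedMass, ← Finset.sum_filter, ← Finset.sum_ite]
      refine Finset.sum_congr ?_ fun _ _ => rfl
      ext x; simp
    refine ⟨fun hg hh => ?_, fun he => ⟨h3 he, ?_⟩⟩
    -- Both normalized masses are 1, so the final excess is 1 - 1 = 0 and no payment is outstanding.
    · rw [← h2, h1, hsum, Finset.sum_const, Finset.sum_const, ← massOne, ← massTwo]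
      have hg' : (massOne (s.nat sideArr) (idClass s N c) : ℝ) ≠ 0 := Nat.cast_ne_zero.2 hg
      have hh' : (massTwo (s.nat sideArr) (idClass s N c) : ℝ) ≠ 0 := Nat.cast_ne_zero.2 hh
      simp [hg', hh']
    · rw [h1, hsum, he]; simp

/-! ## Encoding of multisets by numbers -/

/-- The number of bits before digit `c`, if digit `c` has `b c` bits. -/
def bitPos (b : ℕ → ℕ) (c : ℕ) : ℕ := ∑ i ∈ range c, b i

theorem sum_digits_lt {b a : ℕ → ℕ} {d : ℕ} (h : ∀ c < d, a c < 2 ^ b c) :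
    ∑ c ∈ range d, a c * 2 ^ bitPos b c < 2 ^ bitPos b d := by
  induction d with
  | zero => simp [bitPos]
  | succ d ih =>
    have h1 := ih fun c hc => h c (by omega)
    have h2 : a d + 1 ≤ 2 ^ b d := h d (by omega)
    rw [Finset.sum_range_succ, show bitPos b (d + 1) = b d + bitPos b d by
      rw [bitPos, Finset.sum_range_succ, add_comm]; rfl, pow_add]
    calc _ < 2 ^ bitPos b d + a d * 2 ^ bitPos b d := by omega
      _ = (a d + 1) * 2 ^ bitPos b d := by ring
      _ ≤ _ := Nat.mul_le_mul_right _ h2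

theorem eq_of_add_mul_eq {B r r' q q' : ℕ} (hr : r < B) (hr' : r' < B)
    (h : q * B + r = q' * B + r') : q = q' ∧ r = r' := by
  have hB : 0 < B := by omega
  have hq : q = q' := by
    have h1 : (q * B + r) / B = q := by
      rw [mul_comm, Nat.mul_add_div hB, Nat.div_eq_of_lt hr, add_zero]
    have h2 : (q' * B + r') / B = q' := by
      rw [mul_comm, Nat.mul_add_div hB, Nat.div_eq_of_lt hr', add_zero]
    rw [← h1, ← h2, h]
  subst hq
  exact ⟨rfl, by omega⟩

theorem digits_inj {b a a' : ℕ → ℕ} {d : ℕ} (h : ∀ c < d, a c < 2 ^ b c)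
    (h' : ∀ c < d, a' c < 2 ^ b c)
    (he : ∑ c ∈ range d, a c * 2 ^ bitPos b c = ∑ c ∈ range d, a' c * 2 ^ bitPos b c) :
    ∀ c < d, a c = a' c := by
  induction d with
  | zero => simp
  | succ d ih =>
    rw [Finset.sum_range_succ, Finset.sum_range_succ, add_comm, add_comm _ (a' d * _)] at he
    obtain ⟨h1, h2⟩ := eq_of_add_mul_eq (sum_digits_lt fun c hc => h c (by omega))
      (sum_digits_lt fun c hc => h' c (by omega)) he
    intro c hc
    rcases Nat.lt_succ_iff_lt_or_eq.1 hc with hc | rfl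
    · exact ih (fun c hc => h c (by omega)) (fun c hc => h' c (by omega)) h2 c hc
    · exact h1

theorem sum_map_eq_sum_count {m : Multiset ℕ} {d : ℕ} (hm : ∀ c ∈ m, c < d) (g : ℕ → ℕ) :
    (m.map g).sum = ∑ c ∈ range d, m.count c * g c := by
  rw [Finset.sum_multiset_map_count]
  refine Finset.sum_subset (fun c hc => ?_) fun c _ hc => ?_
  · exact Finset.mem_range.2 (hm c (by simpa using hc))
  · simp [Multiset.count_eq_zero.2 (by simpa using hc)]

/-- Since b < 2^b, a field of `b c` bits holds any count up to `b c`. This generous width is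
affordable because the widths will add up to the number of vertices. -/
theorem multiset_code_lt {m : Multiset ℕ} {b : ℕ → ℕ} {d : ℕ} (hm : ∀ c ∈ m, c < d)
    (h : ∀ c, m.count c ≤ b c) : (m.map fun c => 2 ^ bitPos b c).sum < 2 ^ bitPos b d := by
  rw [sum_map_eq_sum_count hm]
  exact sum_digits_lt fun c _ => (h c).trans_lt Nat.lt_two_pow_self

theorem multiset_code_inj {m m' : Multiset ℕ} {b : ℕ → ℕ} {d : ℕ} (hm : ∀ c ∈ m, c < d)
    (hm' : ∀ c ∈ m', c < d) (h : ∀ c, m.count c ≤ b c) (h' : ∀ c, m'.count c ≤ b c)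
    (he : (m.map fun c => 2 ^ bitPos b c).sum = (m'.map fun c => 2 ^ bitPos b c).sum) :
    m = m' := by
  rw [sum_map_eq_sum_count hm, sum_map_eq_sum_count hm'] at he
  have hc := digits_inj (fun c _ => (h c).trans_lt Nat.lt_two_pow_self)
    (fun c _ => (h' c).trans_lt Nat.lt_two_pow_self) he
  ext c
  by_cases hcd : c < d
  · exact hc c hcd
  · rw [Multiset.count_eq_zero.2 fun hmem => hcd (hm c hmem),
      Multiset.count_eq_zero.2 fun hmem => hcd (hm' c hmem)]

/-- On the indices below `N` the map `g` factors through `f`. The default value of the factor `F` is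
never reached there. -/
theorem map_eq_map_of_factor {β δ : Type*} {m m' : Multiset ℕ} {N : ℕ} {f : ℕ → β} {g : ℕ → δ}
    (hm : ∀ x ∈ m, x < N) (hm' : ∀ x ∈ m', x < N)
    (hfg : ∀ x < N, ∀ y < N, f x = f y → g x = g y) (h : m.map f = m'.map f) :
    m.map g = m'.map g := by
  classical
  let F : β → δ := fun u => if h : ∃ x, x < N ∧ f x = u then g h.choose else g 0
  have hF : ∀ x < N, F (f x) = g x := fun x hx => by
    have hex : ∃ y, y < N ∧ f y = f x := ⟨x, hx, rfl⟩
    simp only [F, dif_pos hex]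
    exact hfg _ hex.choose_spec.1 _ hx hex.choose_spec.2
  have key : ∀ m : Multiset ℕ, (∀ x ∈ m, x < N) → m.map g = (m.map f).map F := fun m hm => by
    rw [Multiset.map_map]
    exact Multiset.map_congr rfl fun x hx => (hF x (hm x hx)).symm
  rw [key m hm, key m' hm', h]

/-! ## Weisfeiler-Lehman labels of a graph given by arrays -/

/-- The multiset of the values at the neighbours of `x`, for the edges listed in two arrays. -/
def neighborValues {β : Type} (M : ℕ) (src tgt : ℕ → ℕ) (f : ℕ → β) (x : ℕ) : Multiset β :=
  ∑ e ∈ range M, ((if src e = x then {f (tgt e)} else 0) + if tgt e = x then {f (src e)} else 0)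

/-- The Weisfeiler-Lehman labels, for vertex labels and edges given by arrays. -/
def arrayLabel (l : ℕ → ℕ) (M : ℕ) (src tgt : ℕ → ℕ) : (i : ℕ) → ℕ → WLAlphabet i
  | 0 => l
  | i + 1 => fun x => (arrayLabel l M src tgt i x,
      neighborValues M src tgt (arrayLabel l M src tgt i) x)

theorem neighborValues_eq_map {β : Type} (M : ℕ) (src tgt : ℕ → ℕ) (f : ℕ → β) (x : ℕ) :
    neighborValues M src tgt f x = (neighborValues M src tgt id x).map f := by
  unfold neighborValues
  rw [← Multiset.coe_mapAddMonoidHom, map_sum]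
  refine Finset.sum_congr rfl fun e _ => ?_
  split_ifs <;> simp

theorem sum_map_neighborValues (M : ℕ) (src tgt : ℕ → ℕ) (f : ℕ → ℕ) (x : ℕ) :
    (neighborValues M src tgt f x).sum = ∑ e ∈ range M,
      ((if src e = x then f (tgt e) else 0) + if tgt e = x then f (src e) else 0) := by
  unfold neighborValues
  rw [← Multiset.coe_sumAddMonoidHom, map_sum]
  refine Finset.sum_congr rfl fun e _ => ?_
  split_ifs <;> simp

theorem lt_of_mem_neighborValues {M N : ℕ} {src tgt : ℕ → ℕ} (hs : ∀ e < M, src e < N)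
    (ht : ∀ e < M, tgt e < N) {x y : ℕ} (hy : y ∈ neighborValues M src tgt id x) : y < N := by
  unfold neighborValues at hy
  obtain ⟨e, he, hy⟩ := Multiset.mem_sum.1 hy
  have he := Finset.mem_range.1 he
  rcases Multiset.mem_add.1 hy with hy | hy <;> split_ifs at hy <;> simp at hy <;>
    subst hy <;> simp [hs e he, ht e he]

/-- The code of an identifier and the multiset of the neighbours' identifiers
determines both of them. -/
theorem code_eq_iff {β : Type} {N M d : ℕ} {src tgt : ℕ → ℕ} (hs : ∀ e < M, src e < N)
    (ht : ∀ e < M, tgt e < N) (hnd : ∀ x < N, (neighborValues M src tgt id x).Nodup)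
    {c : ℕ → ℕ} {f : ℕ → β} (hc : ∀ x < N, c x < d)
    (hcf : ∀ x < N, ∀ y < N, c x = c y ↔ f x = f y) {b : ℕ → ℕ}
    (hb : ∀ i, b i = #{x ∈ range N | c x = i}) {x y : ℕ} (hx : x < N) (hy : y < N) :
    c x * 2 ^ N + (neighborValues M src tgt (fun z => 2 ^ bitPos b (c z)) x).sum
        = c y * 2 ^ N + (neighborValues M src tgt (fun z => 2 ^ bitPos b (c z)) y).sum ↔
      (f x, neighborValues M src tgt f x) = (f y, neighborValues M src tgt f y) := by
  have hlt : ∀ x, ∀ z ∈ neighborValues M src tgt id x, z < N :=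
    fun x z hz => lt_of_mem_neighborValues hs ht hz
  have hmap : ∀ x, neighborValues M src tgt (fun z => 2 ^ bitPos b (c z)) x
      = (neighborValues M src tgt c x).map fun i => 2 ^ bitPos b i := fun x => by
    rw [neighborValues_eq_map M src tgt c, Multiset.map_map, neighborValues_eq_map]; rfl
  have hd : ∀ x, ∀ i ∈ neighborValues M src tgt c x, i < d := fun x i hi => by
    rw [neighborValues_eq_map] at hi
    obtain ⟨z, hz, rfl⟩ := Multiset.mem_map.1 hi
    exact hc z (hlt x z hz)
  -- Neighbours are pairwise distinct vertices, so an identifier occurs among them at most as often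
  -- as among all vertices.
  have hcount : ∀ x < N, ∀ i, (neighborValues M src tgt c x).count i ≤ b i := fun x hx i => by
    rw [neighborValues_eq_map, Multiset.count_map, hb]
    refine Multiset.card_le_card ((Multiset.le_iff_subset ((hnd x hx).filter _)).2 fun z hz => ?_)
    obtain ⟨hz, hi⟩ := Multiset.mem_filter.1 hz
    simpa [hi] using hlt x z hz
  -- The identifier classes partition the vertices, so the fields fill exactly `N` bits and the own
  -- identifier sits above them.
  have hbN : bitPos b d = N := by
    have := Finset.card_eq_sum_card_fiberwise (f := c) (s := range N) (t := range d)
      fun z hz => Finset.mem_coe.2 (Finset.mem_range.2 (hc z (by simpa using hz)))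
    rw [card_range] at this
    rw [bitPos, this]
    exact Finset.sum_congr rfl fun i _ => hb i
  simp only [hmap]
  constructor
  · intro h
    have hlt' : ∀ x < N, ((neighborValues M src tgt c x).map fun i => 2 ^ bitPos b i).sum
        < 2 ^ N := fun x hx => (multiset_code_lt (hd x) (hcount x hx)).trans_eq (by rw [hbN])
    obtain ⟨h1, h2⟩ := eq_of_add_mul_eq (hlt' x hx) (hlt' y hy) h
    have h3 := multiset_code_inj (hd x) (hd y) (hcount x hx) (hcount y hy) h2
    rw [neighborValues_eq_map, neighborValues_eq_map M src tgt c] at h3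
    rw [Prod.mk.injEq, neighborValues_eq_map, neighborValues_eq_map M src tgt f y]
    exact ⟨(hcf x hx y hy).1 h1, map_eq_map_of_factor (hlt x) (hlt y)
      (fun x hx y hy => (hcf x hx y hy).1) h3⟩
  · intro h
    obtain ⟨h1, h2⟩ := Prod.mk.inj h
    rw [neighborValues_eq_map, neighborValues_eq_map M src tgt f y] at h2
    have h3 := map_eq_map_of_factor (hlt x) (hlt y) (fun x hx y hy => (hcf x hx y hy).2) h2
    rw [neighborValues_eq_map, neighborValues_eq_map M src tgt c y, h3, (hcf x hx y hy).2 h1]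

-- A sum of a function of the fibres depends only on the partition into fibres, because unattained
-- values contribute `g ∅ = 0`. This allows labels and identifiers to be interchanged in the kernel.
open Classical in
theorem sum_fibers_eq {β : Type*} {N : ℕ} {f : ℕ → β} {V : Finset β}
    (hV : ∀ x < N, f x ∈ V) {g : Finset ℕ → ℝ} (hg : g ∅ = 0) :
    ∑ v ∈ V, g {x ∈ range N | f x = v}
      = ∑ Q ∈ (range N).image fun x => {y ∈ range N | f y = f x}, g Q := by
  have himg : (range N).image (fun x => {y ∈ range N | f y = f x})
      = ((range N).image f).image fun v => {y ∈ range N | f y = v} := by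
    rw [Finset.image_image]; rfl
  rw [himg, Finset.sum_image]
  · symm
    refine Finset.sum_subset (fun v hv => ?_) fun v _ hv => ?_
    · obtain ⟨x, hx, rfl⟩ := Finset.mem_image.1 hv
      exact hV x (Finset.mem_range.1 hx)
    · rw [Finset.filter_eq_empty_iff.2, hg]
      exact fun x hx h => hv (Finset.mem_image.2 ⟨x, hx, h⟩)
  · intro v hv w _ h
    obtain ⟨x, hx, rfl⟩ := Finset.mem_image.1 (Finset.mem_coe.1 hv)
    have : x ∈ ({y ∈ range N | f y = f x} : Finset ℕ) := by simpa using hx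
    simp only at h
    rw [h] at this
    exact (Finset.mem_filter.1 this).2

open Classical in
theorem sum_fibers_congr {β δ : Type*} {N : ℕ} {f : ℕ → β} {f' : ℕ → δ} {V : Finset β}
    {V' : Finset δ} (hV : ∀ x < N, f x ∈ V) (hV' : ∀ x < N, f' x ∈ V')
    (hff : ∀ x < N, ∀ y < N, f x = f y ↔ f' x = f' y) {g : Finset ℕ → ℝ} (hg : g ∅ = 0) :
    ∑ v ∈ V, g {x ∈ range N | f x = v} = ∑ v ∈ V', g {x ∈ range N | f' x = v} := by
  rw [sum_fibers_eq hV hg, sum_fibers_eq hV' hg]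
  congr 1
  refine Finset.image_congr fun x hx => ?_
  refine Finset.filter_congr fun y hy => ?_
  exact hff y (Finset.mem_range.1 hy) x (by simpa using hx)

/-! ### One round -/

/-- Add the contribution of an identifier to the kernel. -/
def sumBody : Prog :=
  .setReal 4 (.const 0) (.add (.get 4 (.const 0))
    (.mul (.mul (.exp (.mul (.sub (.const 0) (.get 0 (.const 0)))
        (.get distArr (.add (.var lastOld) (.add (.var ctr) (.const 1))))))
      (.get massArrG (.add (.var lastOld) (.add (.var ctr) (.const 1)))))
      (.get massArrH (.add (.var lastOld) (.add (.var ctr) (.const 1))))))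

theorem sum_spec {s : Store} {d : ℕ} (hd : s.nat fresh 0 = d) :
    (Prog.forLoop ctr fresh sumBody).Achieves s (d * (sumBody.maxCost + 11) + 8)
      fun t => t.real 4 0 = s.real 4 0 + ∑ c ∈ range d,
        Real.exp (-s.real 0 0 * s.real distArr (s.nat lastOld 0 + (c + 1)))
          * s.real massArrG (s.nat lastOld 0 + (c + 1))
          * s.real massArrH (s.nat lastOld 0 + (c + 1)) := by
  refine Prog.achieves_forLoop_of_run (fun p t => t.real 4 0 = s.real 4 0 + ∑ c ∈ range p,
        Real.exp (-s.real 0 0 * s.real distArr (s.nat lastOld 0 + (c + 1)))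
          * s.real massArrG (s.nat lastOld 0 + (c + 1))
          * s.real massArrH (s.nat lastOld 0 + (c + 1)))
    (by decide) (by decide) (by decide) hd (by simp) ?_ (fun t _ h => h)
  intro i hi t hA hc h
  have h1 : t.nat lastOld = s.nat lastOld := hA.1 lastOld (by decide)
  have h2 : t.real distArr = s.real distArr := hA.2 distArr (by decide)
  have h3 : t.real massArrG = s.real massArrG := hA.2 massArrG (by decide)
  have h4 : t.real massArrH = s.real massArrH := hA.2 massArrH (by decide)
  have h5 : t.real 0 = s.real 0 := hA.2 0 (by decide)
  simp [sumBody, Prog.run, NatExpr.eval, RealExpr.eval, hc, h1, h2, h3, h4, h5, h,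
    Finset.sum_range_succ]
  ring

/-- Compute the weights by which an identifier enters the codes. -/
def weightBody : Prog :=
  .seq (.setNat weightArr (.add (.var lastOld) (.add (.var ctr) (.const 1)))
      (.get powerArr (.var position)))
    (.seq (.setNat shiftArr (.add (.var lastOld) (.add (.var ctr) (.const 1))) (.var multiple))
      (.seq (.setNat position (.const 0) (.add (.var position)
          (.get countArr (.add (.var lastOld) (.add (.var ctr) (.const 1))))))
        (.setNat multiple (.const 0)
          (.add (.var multiple) (.get powerArr (.var vertexTotal))))))

/-- Natural numbers cannot be multiplied by the machine: `multiple` runs through the multiples of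
2^N by repeated addition, while `position` adds up the field widths and selects a tabulated power of
two. -/
theorem weight_spec {s : Store} {d : ℕ} (hd : s.nat fresh 0 = d) (hp : s.nat position 0 = 0)
    (hm : s.nat multiple 0 = 0) :
    (Prog.forLoop ctr fresh weightBody).Achieves s (d * (weightBody.maxCost + 11) + 8)
      fun t => ∀ c < d,
        t.nat weightArr (s.nat lastOld 0 + (c + 1))
          = s.nat powerArr (bitPos (fun i => s.nat countArr (s.nat lastOld 0 + (i + 1))) c) ∧
        t.nat shiftArr (s.nat lastOld 0 + (c + 1))
          = c * s.nat powerArr (s.nat vertexTotal 0) := by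
  refine Prog.achieves_forLoop_of_run (fun p t =>
      t.nat position 0 = bitPos (fun i => s.nat countArr (s.nat lastOld 0 + (i + 1))) p ∧
      t.nat multiple 0 = p * s.nat powerArr (s.nat vertexTotal 0) ∧ ∀ c < p,
        t.nat weightArr (s.nat lastOld 0 + (c + 1))
          = s.nat powerArr (bitPos (fun i => s.nat countArr (s.nat lastOld 0 + (i + 1))) c) ∧
        t.nat shiftArr (s.nat lastOld 0 + (c + 1))
          = c * s.nat powerArr (s.nat vertexTotal 0))
    (by decide) (by decide) (by decide) hd (by simp [bitPos, hp, hm]) ?_ (fun t _ h => h.2.2)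
  rintro i hi t hA hc ⟨hp, hm, h⟩
  have h1 : t.nat lastOld = s.nat lastOld := hA.1 lastOld (by decide)
  have h2 : t.nat powerArr = s.nat powerArr := hA.1 powerArr (by decide)
  have h3 : t.nat countArr = s.nat countArr := hA.1 countArr (by decide)
  have h4 : t.nat vertexTotal = s.nat vertexTotal := hA.1 vertexTotal (by decide)
  simp [weightBody, Prog.run, NatExpr.eval, hc, h1, h2, h3, h4, hp, hm]
  refine ⟨by simp [bitPos, Finset.sum_range_succ], by ring, fun c hc => ?_⟩
  split_ifs with hci
  · simp [hci]
  · exact h c (by omega)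

/-- Initialize the code of a vertex by its own identifier. -/
def codeBody : Prog :=
  .setNat codeArr (.var ctr) (.get shiftArr (.get idArr (.var ctr)))

theorem code_spec {s : Store} {N : ℕ} (hN : s.nat vertexTotal 0 = N) :
    (Prog.forLoop ctr vertexTotal codeBody).Achieves s (N * (codeBody.maxCost + 11) + 8)
      fun t => ∀ x < N, t.nat codeArr x = s.nat shiftArr (s.nat idArr x) := by
  refine Prog.achieves_forLoop_of_run
    (fun p t => ∀ x < p, t.nat codeArr x = s.nat shiftArr (s.nat idArr x))
    (by decide) (by decide) (by decide) hN (by simp) ?_ (fun t _ h => h)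
  intro i hi t hA hc h
  have h1 : t.nat shiftArr = s.nat shiftArr := hA.1 shiftArr (by decide)
  have h2 : t.nat idArr = s.nat idArr := hA.1 idArr (by decide)
  simp [codeBody, Prog.run, NatExpr.eval, hc, h1, h2]
  intro x hx
  split_ifs with hxi
  · rw [hxi]
  · exact h x (by omega)

/-- Add the weights of the ends of an edge to the codes of the opposite ends. -/
def edgeBody : Prog :=
  .seq (.setNat codeArr (.get sourceArr (.var ctr))
      (.add (.get codeArr (.get sourceArr (.var ctr)))
        (.get weightArr (.get idArr (.get targetArr (.var ctr))))))
    (.setNat codeArr (.get targetArr (.var ctr))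
      (.add (.get codeArr (.get targetArr (.var ctr)))
        (.get weightArr (.get idArr (.get sourceArr (.var ctr))))))

theorem edge_spec {s : Store} {M : ℕ} (hM : s.nat edgeTotal 0 = M) :
    (Prog.forLoop ctr edgeTotal edgeBody).Achieves s (M * (edgeBody.maxCost + 11) + 8)
      fun t => ∀ x, t.nat codeArr x = s.nat codeArr x + (neighborValues M (s.nat sourceArr)
        (s.nat targetArr) (fun y => s.nat weightArr (s.nat idArr y)) x).sum := by
  simp only [sum_map_neighborValues]
  refine Prog.achieves_forLoop_of_run
    (fun p t => ∀ x, t.nat codeArr x = s.nat codeArr x + ∑ e ∈ range p,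
      ((if s.nat sourceArr e = x then s.nat weightArr (s.nat idArr (s.nat targetArr e)) else 0)
        + if s.nat targetArr e = x then s.nat weightArr (s.nat idArr (s.nat sourceArr e)) else 0))
    (by decide) (by decide) (by decide) hM (by simp) ?_ (fun t _ h => h)
  intro i hi t hA hc h x
  have h1 : t.nat weightArr = s.nat weightArr := hA.1 weightArr (by decide)
  have h2 : t.nat idArr = s.nat idArr := hA.1 idArr (by decide)
  have h3 : t.nat sourceArr = s.nat sourceArr := hA.1 sourceArr (by decide)
  have h4 : t.nat targetArr = s.nat targetArr := hA.1 targetArr (by decide)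
  rw [Finset.sum_range_succ, ← add_assoc, ← h x]
  simp [edgeBody, Prog.run, NatExpr.eval, hc, h1, h2, h3, h4]
  simp only [eq_comm (a := x)]
  split_ifs <;> simp_all
  ring

/-- One round: relabel, add up the contributions of the identifiers, compute new codes. -/
def roundBody (i₀ : ℕ) : Prog :=
  .seq (.setNat lastOld (.const 0) (.var lastUsed))
  (.seq (.forLoop ctr vertexTotal relabelBody)
  (.seq (.forLoop ctr vertexTotal countBody)
  (.seq (.forLoop ctr vertexTotal distBody)
  (.seq (.setNat fresh (.const 0) (.sub (.var lastUsed) (.var lastOld)))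
  (.seq (.cond (.natLt (.var levelCtr) (.const i₀)) .nop (.forLoop ctr fresh sumBody))
  (.seq (.setNat position (.const 0) (.const 0))
  (.seq (.setNat multiple (.const 0) (.const 0))
  (.seq (.forLoop ctr fresh weightBody)
  (.seq (.forLoop ctr vertexTotal codeBody)
    (.forLoop ctr edgeTotal edgeBody))))))))))

/-- The contribution of a class of vertices with the same label. -/
noncomputable def classTerm (γ : ℝ) (S : ℕ → ℕ) (A : ℕ → ℝ) (N : ℕ) (Q : Finset ℕ) : ℝ :=
  Real.exp (-γ * partialDist S A Q N) * massOne S Q * massTwo S Q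

open Classical in
/-- The contribution of all labels of a round. -/
noncomputable def roundSum {β : Type} (γ : ℝ) (S : ℕ → ℕ) (A : ℕ → ℝ) (N : ℕ) (f : ℕ → β) : ℝ :=
  ∑ v ∈ (range N).image f, classTerm γ S A N {x ∈ range N | f x = v}

/-- The data that stay fixed during all rounds. -/
structure FlatInput (N M : ℕ) (γ : ℝ) (S src tgt : ℕ → ℕ) (A : ℕ → ℝ) (s : Store) : Prop where
  size : s.nat vertexTotal 0 = N
  edges : s.nat edgeTotal 0 = M
  side_eq : s.nat sideArr = S
  source_eq : s.nat sourceArr = src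
  target_eq : s.nat targetArr = tgt
  level_eq : s.real levelArr = A
  gamma : s.real 0 0 = γ
  power_eq : ∀ t ≤ N, s.nat powerArr t = 2 ^ t

/-- The memory at the start of a round, for labels `f` and an intermediate result `r`. -/
structure RoundState {β : Type} (N : ℕ) (f : ℕ → β) (r : ℝ) (s : Store) : Prop where
  dict_le : ∀ z, s.nat dictArr z ≤ s.nat lastUsed 0
  count_zero : ∀ c, s.nat lastUsed 0 < c → s.nat countArr c = 0
  massG_zero : ∀ c, s.nat lastUsed 0 < c → s.real massArrG c = 0
  massH_zero : ∀ c, s.nat lastUsed 0 < c → s.real massArrH c = 0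
  dist_zero : ∀ c, s.nat lastUsed 0 < c → s.real distArr c = 0
  excess_zero : ∀ c, s.nat lastUsed 0 < c → s.real excessArr c = 0
  code_eq_iff : ∀ x < N, ∀ y < N, s.nat codeArr x = s.nat codeArr y ↔ f x = f y
  result : s.real 4 0 = r

theorem FlatInput.of_agreeOff {N M : ℕ} {γ : ℝ} {S src tgt : ℕ → ℕ} {A : ℕ → ℝ} {s t : Store}
    (h : FlatInput N M γ S src tgt A s) {W R : List ℕ} (hA : s.AgreeOff W R t)
    (hW : ∀ a ∈ [vertexTotal, edgeTotal, sideArr, sourceArr, targetArr, powerArr], a ∉ W)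
    (hR : ∀ a ∈ [levelArr, 0], a ∉ R) : FlatInput N M γ S src tgt A t := by
  simp only [List.mem_cons, List.not_mem_nil, or_false, forall_eq_or_imp, forall_eq] at hW hR
  obtain ⟨w1, w2, w3, w4, w5, w6⟩ := hW
  refine ⟨?_, ?_, ?_, ?_, ?_, ?_, ?_, ?_⟩
  · rw [hA.1 _ w1, h.size]
  · rw [hA.1 _ w2, h.edges]
  · rw [hA.1 _ w3, h.side_eq]
  · rw [hA.1 _ w4, h.source_eq]
  · rw [hA.1 _ w5, h.target_eq]
  · rw [hA.2 _ hR.1, h.level_eq]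
  · rw [hA.2 _ hR.2, h.gamma]
  · rw [hA.1 _ w6]; exact h.power_eq

theorem classTerm_empty (γ : ℝ) (S : ℕ → ℕ) (A : ℕ → ℝ) (N : ℕ) : classTerm γ S A N ∅ = 0 := by
  simp [classTerm, massOne]

theorem neighborValues_congr {β : Type} {M N : ℕ} {src tgt : ℕ → ℕ} (hs : ∀ e < M, src e < N)
    (ht : ∀ e < M, tgt e < N) {f g : ℕ → β} (h : ∀ x < N, f x = g x) (x : ℕ) :
    neighborValues M src tgt f x = neighborValues M src tgt g x := by
  rw [neighborValues_eq_map, neighborValues_eq_map M src tgt g]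
  exact Multiset.map_congr rfl fun y hy => h y (lt_of_mem_neighborValues hs ht hy)

/-- Powers of two are tabulated only up to exponent `N`; this keeps every lookup inside the table.
-/
theorem bitPos_card_fibers_le {N : ℕ} (c : ℕ → ℕ) (d : ℕ) :
    bitPos (fun i => #{x ∈ range N | c x = i}) d ≤ N := by
  have h : bitPos (fun i => #{x ∈ range N | c x = i}) d
      = ∑ x ∈ range N, ∑ i ∈ range d, if c x = i then 1 else 0 := by
    rw [bitPos, Finset.sum_comm]
    exact Finset.sum_congr rfl fun i _ => Finset.card_filter _ _
  rw [h]
  refine (Finset.sum_le_card_nsmul _ _ 1 fun x _ => ?_).trans (by simp)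
  rw [Finset.sum_ite_eq]
  split_ifs <;> simp

theorem cond_sum_spec {s : Store} {d i₀ : ℕ} (hd : s.nat fresh 0 = d) :
    (Prog.cond (.natLt (.var levelCtr) (.const i₀)) .nop (.forLoop ctr fresh sumBody)).Achieves s
      (4 + (d * (sumBody.maxCost + 11) + 8))
      fun t => t.real 4 0 = s.real 4 0 + if s.nat levelCtr 0 < i₀ then 0 else ∑ c ∈ range d,
        Real.exp (-s.real 0 0 * s.real distArr (s.nat lastOld 0 + (c + 1)))
          * s.real massArrG (s.nat lastOld 0 + (c + 1))
          * s.real massArrH (s.nat lastOld 0 + (c + 1)) := by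
  refine Prog.Achieves.cond (b := .natLt (.var levelCtr) (.const i₀)) (fun h => ?_) fun h => ?_
  · have h' : s.nat levelCtr 0 < i₀ := h
    exact ⟨s, 1, .nop s, by omega, by simp [h']⟩
  · have h' : ¬ s.nat levelCtr 0 < i₀ := h
    exact (sum_spec hd).mono le_rfl fun t _ ht => by rw [ht, if_neg h']

/-- Identifiers of this round lie strictly above the old `lastUsed`, where the accumulating arrays
are zero, so the accumulated values are exact. The weights and shifts are written before they are
read and need no such condition. The new codes separate exactly the pairs (label, multiset of
neighbouring labels), which restores the invariant. -/
theorem round_spec {β : Type} {N M : ℕ} {γ r : ℝ} {S src tgt : ℕ → ℕ} {A : ℕ → ℝ} {s : Store}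
    {f : ℕ → β} (i₀ : ℕ) (hs : ∀ e < M, src e < N) (ht : ∀ e < M, tgt e < N)
    (hnd : ∀ x < N, (neighborValues M src tgt id x).Nodup)
    (hF : FlatInput N M γ S src tgt A s) (hR : RoundState N f r s) :
    (roundBody i₀).Achieves s (1000 * (N + M + 1)) fun t =>
      RoundState N (fun x => (f x, neighborValues M src tgt f x))
        (r + if s.nat levelCtr 0 < i₀ then 0 else roundSum γ S A N f) t := by
  have E₁ := Exec.setNat s lastOld (.const 0) (.var lastUsed)
  have A₁ := E₁.agreeOff
  simp only [NatExpr.eval] at E₁ A₁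
  generalize hs₁ : s.setNat lastOld 0 (s.nat lastUsed 0) = s₁ at E₁ A₁
  have F₁ := hF.of_agreeOff A₁ (by decide) (by decide)
  have u₁ : s₁.nat lastUsed = s.nat lastUsed := A₁.1 _ (by decide)
  have o₁ : s₁.nat lastOld 0 = s.nat lastUsed 0 := by rw [← hs₁]; simp
  have c₁ : s₁.nat codeArr = s.nat codeArr := A₁.1 _ (by decide)
  -- identifiers
  obtain ⟨s₂, t₂, E₂, b₂, d₂, l₂, l₂', i₂, i₂'⟩ := relabel_spec F₁.size
    (by rw [u₁, A₁.1 dictArr (by decide)]; exact hR.dict_le) (by rw [o₁, u₁])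
  have A₂ := E₂.agreeOff
  have F₂ := F₁.of_agreeOff A₂ (by decide) (by decide)
  rw [u₁] at l₂ l₂' i₂
  simp only [c₁] at i₂'
  -- counts
  obtain ⟨s₃, t₃, E₃, b₃, n₃, g₃, h₃⟩ := count_spec F₂.size
  have A₃ := E₃.agreeOff
  have F₃ := F₂.of_agreeOff A₃ (by decide) (by decide)
  have id₃ : s₃.nat idArr = s₂.nat idArr := A₃.1 _ (by decide)
  generalize hb : s.nat lastUsed 0 = b at *
  -- Only cells above `b` are meaningful; those below may keep data of earlier rounds.
  have n₃' : ∀ c, b < c → s₃.nat countArr c = #{x ∈ range N | s₂.nat idArr x = c} := fun c hc => by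
    rw [n₃, A₂.1 countArr (by decide), A₁.1 countArr (by decide),
      hR.count_zero c (hb.symm ▸ hc), zero_add]
  have g₃' : ∀ c, b < c → s₃.real massArrG c = massOne (s₃.nat sideArr) (idClass s₃ N c) :=
    fun c hc => by
      rw [g₃, A₂.2 massArrG (by decide), A₁.2 massArrG (by decide),
        hR.massG_zero c (hb.symm ▸ hc), zero_add, massOne, idClass, Finset.filter_filter, id₃,
        F₃.side_eq, F₂.side_eq]
  have h₃' : ∀ c, b < c → s₃.real massArrH c = massTwo (s₃.nat sideArr) (idClass s₃ N c) :=
    fun c hc => by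
      rw [h₃, A₂.2 massArrH (by decide), A₁.2 massArrH (by decide),
        hR.massH_zero c (hb.symm ▸ hc), zero_add, massTwo, idClass, Finset.filter_filter, id₃,
        F₃.side_eq, F₂.side_eq]
  -- distances
  obtain ⟨s₄, t₄, E₄, b₄, q₄⟩ := dist_spec (b := b) F₃.size g₃' h₃'
    (fun c hc => by
      rw [A₃.2 distArr (by decide), A₂.2 distArr (by decide), A₁.2 distArr (by decide),
        hR.dist_zero c (hb.symm ▸ hc)])
    (fun c hc => by
      rw [A₃.2 excessArr (by decide), A₂.2 excessArr (by decide), A₁.2 excessArr (by decide),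
        hR.excess_zero c (hb.symm ▸ hc)])
  have A₄ := E₄.agreeOff
  have F₄ := F₃.of_agreeOff A₄ (by decide) (by decide)
  -- contributions
  have E₅ := Exec.setNat s₄ fresh (.const 0) (.sub (.var lastUsed) (.var lastOld))
  have A₅ := E₅.agreeOff
  simp only [NatExpr.eval] at E₅ A₅
  have u₄ : s₄.nat lastUsed = s₂.nat lastUsed :=
    (A₄.1 _ (by decide)).trans (A₃.1 _ (by decide))
  have o₄ : s₄.nat lastOld 0 = b := by
    rw [A₄.1 lastOld (by decide), A₃.1 lastOld (by decide), A₂.1 lastOld (by decide), o₁]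
  rw [u₄, o₄] at E₅ A₅
  generalize hd : s₂.nat lastUsed 0 - b = d at E₅ A₅
  generalize hs₅ : s₄.setNat fresh 0 d = s₅ at E₅ A₅
  have F₅ := F₄.of_agreeOff A₅ (by decide) (by decide)
  obtain ⟨s₆, t₆, E₆, b₆, r₆⟩ := cond_sum_spec (i₀ := i₀) (show s₅.nat fresh 0 = d by
    rw [← hs₅]; simp)
  have A₆ : s₅.AgreeOff [ctr, ctr] [4] s₆ := E₆.agreeOff
  have F₆ := F₅.of_agreeOff A₆ (by decide) (by decide)
  -- weights
  have E₇ := Exec.setNat s₆ position (.const 0) (.const 0)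
  have A₇ := E₇.agreeOff
  simp only [NatExpr.eval] at E₇ A₇
  generalize hs₇ : s₆.setNat position 0 0 = s₇ at E₇ A₇
  have F₇ := F₆.of_agreeOff A₇ (by decide) (by decide)
  have E₈ := Exec.setNat s₇ multiple (.const 0) (.const 0)
  have A₈ := E₈.agreeOff
  simp only [NatExpr.eval] at E₈ A₈
  generalize hs₈ : s₇.setNat multiple 0 0 = s₈ at E₈ A₈
  have F₈ := F₇.of_agreeOff A₈ (by decide) (by decide)
  obtain ⟨s₉, t₉, E₉, b₉, w₉⟩ := weight_spec (s := s₈) (d := d)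
    (by rw [A₈.1 fresh (by decide), A₇.1 fresh (by decide), A₆.1 fresh (by decide), ← hs₅]; simp)
    (by rw [← hs₈, ← hs₇]; simp) (by rw [← hs₈]; simp)
  have A₉ := E₉.agreeOff
  have F₉ := F₈.of_agreeOff A₉ (by decide) (by decide)
  -- codes
  obtain ⟨s₁₀, t₁₀, E₁₀, b₁₀, c₁₀⟩ := code_spec F₉.size
  have A₁₀ := E₁₀.agreeOff
  have F₁₀ := F₉.of_agreeOff A₁₀ (by decide) (by decide)
  obtain ⟨s₁₁, t₁₁, E₁₁, b₁₁, c₁₁⟩ := edge_spec F₁₀.edges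
  have A₁₁ := E₁₁.agreeOff
  -- unchanged arrays
  have A₅₈ : ∀ a, a ∉ [fresh, position, multiple, ctr] → s₈.nat a = s₄.nat a := fun a ha => by
    simp only [List.mem_cons, List.not_mem_nil, or_false, not_or] at ha
    rw [A₈.1 a (by simp [Prog.natWrites, ha]), A₇.1 a (by simp [Prog.natWrites, ha]),
      A₆.1 a (by simp [ha]),
      A₅.1 a (by simp [Prog.natWrites, ha])]
  have o₈ : s₈.nat lastOld 0 = b := by rw [A₅₈ _ (by decide), o₄]
  have n₈ : ∀ c, b < c → s₈.nat countArr c = #{x ∈ range N | s₂.nat idArr x = c} := fun c hc => by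
    rw [A₅₈ _ (by decide), A₄.1 countArr (by decide), n₃' c hc]
  have id₈ : s₈.nat idArr = s₂.nat idArr := by
    rw [A₅₈ _ (by decide), A₄.1 idArr (by decide), id₃]
  have id₉ : s₉.nat idArr = s₂.nat idArr := by rw [A₉.1 idArr (by decide), id₈]
  have id₁₀ : s₁₀.nat idArr = s₂.nat idArr := by rw [A₁₀.1 idArr (by decide), id₉]
  have hdN : d ≤ N := by omega
  -- identifiers, counted from zero
  set c : ℕ → ℕ := fun x => s₂.nat idArr x - (b + 1) with hcdef
  have hidc : ∀ x < N, s₂.nat idArr x = b + (c x + 1) := fun x hx => by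
    have := (i₂ x hx).1; simp only [hcdef]; omega
  have hcd : ∀ x < N, c x < d := fun x hx => by
    have := (i₂ x hx).1; have := (i₂ x hx).2; simp only [hcdef]; omega
  have hcf : ∀ x < N, ∀ y < N, c x = c y ↔ f x = f y := fun x hx y hy => by
    rw [← hR.code_eq_iff x hx y hy, ← i₂' x hx y hy, hidc x hx, hidc y hy]
    omega
  have hfib : ∀ v, ({x ∈ range N | s₂.nat idArr x = b + (v + 1)} : Finset ℕ)
      = {x ∈ range N | c x = v} := fun v => by
    refine Finset.filter_congr fun x hx => ?_
    rw [hidc x (Finset.mem_range.1 hx)]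
    omega
  have hbits : (fun i => s₈.nat countArr (b + (i + 1))) = fun i => #{x ∈ range N | c x = i} := by
    funext i
    rw [n₈ _ (by omega), hfib]
  rw [o₈, F₈.size] at w₉
  simp only [hbits] at w₉
  set bits : ℕ → ℕ := fun i => #{x ∈ range N | c x = i} with hbitsdef
  have hpow : ∀ t ≤ N, s₈.nat powerArr t = 2 ^ t := F₈.power_eq
  have hcode : ∀ x < N, s₁₁.nat codeArr x = c x * 2 ^ N
      + (neighborValues M src tgt (fun z => 2 ^ bitPos bits (c z)) x).sum := fun x hx => by
    rw [c₁₁, c₁₀ x hx, F₁₀.source_eq, F₁₀.target_eq, id₉, id₁₀, hidc x hx,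
      (w₉ _ (hcd x hx)).2, hpow N le_rfl, A₁₀.1 weightArr (by decide)]
    congr 2
    refine neighborValues_congr hs ht (fun z hz => ?_) x
    rw [hidc z hz, (w₉ _ (hcd z hz)).1, hpow _ (bitPos_card_fibers_le c _)]
  have hsum : (∑ v ∈ range d, Real.exp (-s₅.real 0 0 * s₅.real distArr (s₅.nat lastOld 0 + (v + 1)))
          * s₅.real massArrG (s₅.nat lastOld 0 + (v + 1))
          * s₅.real massArrH (s₅.nat lastOld 0 + (v + 1))) = roundSum γ S A N f := by
    have key : ∀ v, Real.exp (-s₅.real 0 0 * s₅.real distArr (s₅.nat lastOld 0 + (v + 1)))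
        * s₅.real massArrG (s₅.nat lastOld 0 + (v + 1))
        * s₅.real massArrH (s₅.nat lastOld 0 + (v + 1))
        = classTerm γ S A N {x ∈ range N | c x = v} := fun v => by
      have hcls : idClass s₃ N (b + (v + 1)) = {x ∈ range N | c x = v} := by
        rw [idClass, id₃, hfib]
      have hq := (q₄ (b + (v + 1)) (by omega)).1
      rw [hcls, F₃.side_eq, F₃.level_eq] at hq
      rw [F₅.gamma, A₅.1 lastOld (by decide), o₄, A₅.2 distArr (by decide),
        A₅.2 massArrG (by decide), A₅.2 massArrH (by decide), A₄.2 massArrG (by decide),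
        A₄.2 massArrH (by decide), g₃' _ (by omega), h₃' _ (by omega), hcls, F₃.side_eq, classTerm]
      -- If one graph does not meet the class, the computed distance has no meaning, but the product
      -- is zero on both sides.
      by_cases hg : massOne S {x ∈ range N | c x = v} = 0
      · simp [hg]
      by_cases hh : massTwo S {x ∈ range N | c x = v} = 0
      · simp [hh]
      rw [hq hg hh]
    simp only [key]
    classical
    -- Labels and identifiers induce the same partition, so the machine may sum over identifiers.
    rw [roundSum, ← sum_fibers_congr (f := c) (V := range d)
      (fun x hx => Finset.mem_range.2 (hcd x hx))
      (fun x hx => Finset.mem_image_of_mem _ (Finset.mem_range.2 hx)) hcf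
      (classTerm_empty γ S A N)]
    refine Finset.sum_congr rfl fun v _ => ?_
    congr
  refine ⟨s₁₁, _, .seq E₁ (.seq E₂ (.seq E₃ (.seq E₄ (.seq E₅ (.seq E₆ (.seq E₇ (.seq E₈
    (.seq E₉ (.seq E₁₀ E₁₁))))))))), ?_, ?_⟩
  -- Four loops over vertices, two over at most `N` identifiers and one over edges cost at most 111
  -- per iteration.
  · have m₂ : relabelBody.maxCost ≤ 100 := by decide
    have m₃ : countBody.maxCost ≤ 100 := by decide
    have m₄ : distBody.maxCost ≤ 100 := by decide
    have m₆ : sumBody.maxCost ≤ 100 := by decide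
    have m₉ : weightBody.maxCost ≤ 100 := by decide
    have m₁₀ : codeBody.maxCost ≤ 100 := by decide
    have m₁₁ : edgeBody.maxCost ≤ 100 := by decide
    have bound : ∀ {n K m : ℕ}, K ≤ 100 → n ≤ m → n * (K + 11) ≤ 111 * m := fun hK hn => by
      rw [mul_comm]; exact Nat.mul_le_mul (by omega) hn
    have := bound m₂ (le_refl N)
    have := bound m₃ (le_refl N)
    have := bound m₄ (le_refl N)
    have := bound m₆ hdN
    have := bound m₉ hdN
    have := bound m₁₀ (le_refl N)
    have := bound m₁₁ (le_refl M)
    simp only [NatExpr.cost]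
    omega
  · have u₁₁ : s₁₁.nat lastUsed = s₂.nat lastUsed := by
      rw [A₁₁.1 _ (by decide), A₁₀.1 _ (by decide), A₉.1 _ (by decide), A₅₈ _ (by decide), u₄]
    -- Identifiers not yet issued have empty classes, hence counts, masses, distances and excesses
    -- zero.
    have hempty : ∀ c, s₂.nat lastUsed 0 < c → idClass s₃ N c = ∅ := fun c hc => by
      refine Finset.filter_eq_empty_iff.2 fun x hx h => ?_
      rw [id₃] at h
      have := (i₂ x (Finset.mem_range.1 hx)).2
      omega
    refine ⟨?_, ?_, ?_, ?_, ?_, ?_, ?_, ?_⟩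
    · rw [u₁₁, A₁₁.1 _ (by decide), A₁₀.1 _ (by decide), A₉.1 _ (by decide), A₅₈ _ (by decide),
        A₄.1 dictArr (by decide), A₃.1 dictArr (by decide)]
      exact d₂
    · rw [u₁₁]
      intro c hc
      rw [A₁₁.1 _ (by decide), A₁₀.1 _ (by decide), A₉.1 _ (by decide), n₈ c (by omega), ← id₃]
      exact Finset.card_eq_zero.2 (hempty c hc)
    · rw [u₁₁]
      intro c hc
      rw [A₁₁.2 _ (by decide), A₁₀.2 _ (by decide), A₉.2 _ (by decide), A₈.2 _ (by decide),
        A₇.2 _ (by decide), A₆.2 _ (by decide), A₅.2 _ (by decide), A₄.2 massArrG (by decide),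
        g₃' c (by omega), hempty c hc]
      simp [massOne]
    · rw [u₁₁]
      intro c hc
      rw [A₁₁.2 _ (by decide), A₁₀.2 _ (by decide), A₉.2 _ (by decide), A₈.2 _ (by decide),
        A₇.2 _ (by decide), A₆.2 _ (by decide), A₅.2 _ (by decide), A₄.2 massArrH (by decide),
        h₃' c (by omega), hempty c hc]
      simp [massTwo]
    · rw [u₁₁]
      intro c hc
      rw [A₁₁.2 _ (by decide), A₁₀.2 _ (by decide), A₉.2 _ (by decide), A₈.2 _ (by decide),
        A₇.2 _ (by decide), A₆.2 _ (by decide), A₅.2 _ (by decide),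
        ((q₄ c (by omega)).2 (hempty c hc)).1]
    · rw [u₁₁]
      intro c hc
      rw [A₁₁.2 _ (by decide), A₁₀.2 _ (by decide), A₉.2 _ (by decide), A₈.2 _ (by decide),
        A₇.2 _ (by decide), A₆.2 _ (by decide), A₅.2 _ (by decide),
        ((q₄ c (by omega)).2 (hempty c hc)).2]
    · intro x hx y hy
      rw [hcode x hx, hcode y hy]
      exact code_eq_iff hs ht hnd hcd hcf (fun _ => rfl) hx hy
    · rw [A₁₁.2 _ (by decide), A₁₀.2 _ (by decide), A₉.2 _ (by decide), A₈.2 _ (by decide),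
        A₇.2 _ (by decide), r₆, hsum, A₅.2 _ (by decide), A₄.2 4 (by decide), A₃.2 4 (by decide),
        A₂.2 4 (by decide), A₁.2 4 (by decide), hR.result, A₅.1 levelCtr (by decide),
        A₄.1 levelCtr (by decide), A₃.1 levelCtr (by decide), A₂.1 levelCtr (by decide),
        A₁.1 levelCtr (by decide)]

/-- The contributions of the first `i` rounds. -/
noncomputable def partialKernel (γ : ℝ) (S l : ℕ → ℕ) (A : ℕ → ℝ) (N M : ℕ) (src tgt : ℕ → ℕ)
    (i₀ i : ℕ) : ℝ :=
  ∑ j ∈ range i, if j < i₀ then 0 else roundSum γ S A N (arrayLabel l M src tgt j)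

theorem rounds_spec {N M h : ℕ} {γ : ℝ} {S l src tgt : ℕ → ℕ} {A : ℕ → ℝ} {s : Store}
    (i₀ : ℕ) (hs : ∀ e < M, src e < N) (ht : ∀ e < M, tgt e < N)
    (hnd : ∀ x < N, (neighborValues M src tgt id x).Nodup) (hh : s.nat levels 0 = h)
    (hF : FlatInput N M γ S src tgt A s) (hR : RoundState N l 0 s) :
    (Prog.forLoop levelCtr levels (roundBody i₀)).Achieves s (h * (1000 * (N + M + 1) + 11) + 8)
      fun t => t.real 4 0 = partialKernel γ S l A N M src tgt i₀ h := by
  -- The parameter `i₀` occurs only in a test. Replacing it by 0 makes the lists of written arrays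
  -- closed terms for `decide`.
  have hW : (roundBody i₀).natWrites = (roundBody 0).natWrites := rfl
  have hW' : (roundBody i₀).realWrites = (roundBody 0).realWrites := rfl
  refine Prog.achieves_forLoop
    (fun i t => RoundState N (arrayLabel l M src tgt i) (partialKernel γ S l A N M src tgt i₀ i) t)
    (by rw [hW]; decide) (by rw [hW]; decide) hh ?_ ?_ (fun t _ h => h.result)
  · have hz : partialKernel γ S l A N M src tgt i₀ 0 = 0 := by simp [partialKernel]
    rw [hz]
    obtain ⟨h1, h2, h3, h4, h5, h6, h7, h8⟩ := hR
    exact ⟨by simpa using h1, by simpa using h2, h3, h4, h5, h6,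
      fun x hx y hy => by simp only [Store.setNat_nat]; exact h7 x hx y hy, h8⟩
  · intro i hi t hA hc hI
    rw [hW, hW'] at hA
    have hFt := hF.of_agreeOff hA (by decide) (by decide)
    refine (round_spec i₀ hs ht hnd hFt hI).mono le_rfl fun t' _ ht' => ?_
    rw [hc] at ht'
    obtain ⟨h1, h2, h3, h4, h5, h6, h7, h8⟩ := ht'
    refine ⟨by simpa using h1, by simpa using h2, by simpa using h3, by simpa using h4,
      by simpa using h5, by simpa using h6, ?_, ?_⟩
    · simp only [Store.setNat_nat]
      exact h7
    · rw [Store.setNat_real, h8, partialKernel, partialKernel, Finset.sum_range_succ]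

/-! ### Preparation -/

/-- Append a vertex label of the second graph to those of the first. -/
def mergeLabelBody : Prog :=
  .setNat 1 (.add (.var sizeG) (.var ctr)) (.get 4 (.var ctr))

/-- Append an edge of the second graph to those of the first. -/
def mergeEdgeBody : Prog :=
  .seq (.setNat 2 (.add (.var edgesG) (.var ctr)) (.add (.var sizeG) (.get 5 (.var ctr))))
    (.seq (.setNat 3 (.add (.var edgesG) (.var ctr)) (.add (.var sizeG) (.get 6 (.var ctr))))
      (.setReal 2 (.add (.var edgesG) (.var ctr)) (.get 3 (.var ctr))))

/-- Append a vertex to the current copy of the disjoint union of both graphs. -/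
def copyVertexBody : Prog :=
  .seq (.setNat codeArr (.var vertexTotal) (.get 1 (.var ctr)))
    (.seq (.setReal levelArr (.var vertexTotal) (.get 1 (.var copyCtr)))
      (.seq (.cond (.natLt (.var ctr) (.var sizeG))
          (.setNat sideArr (.var vertexTotal) (.const 1))
          (.setNat sideArr (.var vertexTotal) (.const 0)))
        (.setNat vertexTotal (.const 0) (.add (.var vertexTotal) (.const 1)))))

/-- Append an edge to the current copy, if its weight reaches the threshold. -/
def copyEdgeBody : Prog :=
  .cond (.realLe (.get 1 (.var copyCtr)) (.get 2 (.var ctr)))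
    (.seq (.setNat sourceArr (.var edgeTotal) (.add (.var offset) (.get 2 (.var ctr))))
      (.seq (.setNat targetArr (.var edgeTotal) (.add (.var offset) (.get 3 (.var ctr))))
        (.setNat edgeTotal (.const 0) (.add (.var edgeTotal) (.const 1)))))
    .nop

/-- Append a copy of the disjoint union of both graphs, restricted to the heavy edges. -/
def copyBody : Prog :=
  .seq (.setNat offset (.const 0) (.var vertexTotal))
    (.seq (.forLoop ctr sizeBoth copyVertexBody) (.forLoop ctr edgesBoth copyEdgeBody))

/-- Compute the next power of two. -/
def powerBody : Prog :=
  .setNat powerArr (.add (.var ctr) (.const 1))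
    (.add (.get powerArr (.var ctr)) (.get powerArr (.var ctr)))

/-- Read the sizes. -/
def headerProg : Prog :=
  .seq (.setNat sizeG (.const 0) (.get 0 (.const 2)))
  (.seq (.setNat edgesG (.const 0) (.get 0 (.const 3)))
  (.seq (.setNat sizeH (.const 0) (.get 0 (.const 4)))
  (.seq (.setNat edgesH (.const 0) (.get 0 (.const 5)))
  (.seq (.setNat copies (.const 0) (.get 0 (.const 1)))
  (.seq (.setNat levels (.const 0) (.add (.get 0 (.const 0)) (.const 1)))
  (.seq (.setNat sizeBoth (.const 0) (.add (.var sizeG) (.var sizeH)))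
  (.seq (.setNat edgesBoth (.const 0) (.add (.var edgesG) (.var edgesH)))
    (.setNat powerArr (.const 0) (.const 1)))))))))

/-- Lay out the filtration graphs of both graphs as one graph. -/
def prepareProg : Prog :=
  .seq headerProg
  (.seq (.forLoop ctr sizeH mergeLabelBody)
  (.seq (.forLoop ctr edgesH mergeEdgeBody)
  (.seq (.forLoop copyCtr copies copyBody)
    (.forLoop ctr vertexTotal powerBody))))

theorem mergeLabel_spec {s : Store} {n n' : ℕ} (hn : s.nat sizeG 0 = n)
    (hn' : s.nat sizeH 0 = n') :
    (Prog.forLoop ctr sizeH mergeLabelBody).Achieves s (n' * (mergeLabelBody.maxCost + 11) + 8)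
      fun t => ∀ x < n + n', t.nat 1 x = if x < n then s.nat 1 x else s.nat 4 (x - n) := by
  refine Prog.achieves_forLoop_of_run
    (fun p t => ∀ x < n + p, t.nat 1 x = if x < n then s.nat 1 x else s.nat 4 (x - n))
    (by decide) (by decide) (by decide) hn' ?_ ?_ (fun t _ h => h)
  · intro x hx
    simp only [Store.setNat_nat]
    rw [if_pos (show x < n by omega)]
    simp
  · intro i hi t hA hc h x hx
    have h1 : t.nat sizeG = s.nat sizeG := hA.1 _ (by decide)
    have h2 : t.nat 4 = s.nat 4 := hA.1 _ (by decide)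
    simp only [mergeLabelBody, Prog.run, NatExpr.eval, hc, h1, h2, hn, Store.setNat_nat]
    by_cases hxi : x = n + i
    · simp [hxi]
    · simpa [hxi] using h x (by omega)

theorem mergeEdge_spec {s : Store} {n m m' : ℕ} (hn : s.nat sizeG 0 = n)
    (hm : s.nat edgesG 0 = m) (hm' : s.nat edgesH 0 = m') :
    (Prog.forLoop ctr edgesH mergeEdgeBody).Achieves s (m' * (mergeEdgeBody.maxCost + 11) + 8)
      fun t => ∀ x < m + m',
        (t.nat 2 x = if x < m then s.nat 2 x else n + s.nat 5 (x - m)) ∧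
        (t.nat 3 x = if x < m then s.nat 3 x else n + s.nat 6 (x - m)) ∧
        (t.real 2 x = if x < m then s.real 2 x else s.real 3 (x - m)) := by
  refine Prog.achieves_forLoop_of_run (fun p t => ∀ x < m + p,
        (t.nat 2 x = if x < m then s.nat 2 x else n + s.nat 5 (x - m)) ∧
        (t.nat 3 x = if x < m then s.nat 3 x else n + s.nat 6 (x - m)) ∧
        (t.real 2 x = if x < m then s.real 2 x else s.real 3 (x - m)))
    (by decide) (by decide) (by decide) hm' ?_ ?_ (fun t _ h => h)
  · intro x hx
    have hx' : x < m := by omega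
    simp [hx']
  · intro i hi t hA hc h x hx
    have h1 : t.nat sizeG = s.nat sizeG := hA.1 _ (by decide)
    have h2 : t.nat 5 = s.nat 5 := hA.1 _ (by decide)
    have h3 : t.nat 6 = s.nat 6 := hA.1 _ (by decide)
    have h4 : t.real 3 = s.real 3 := hA.2 _ (by decide)
    have h5 : t.nat edgesG = s.nat edgesG := hA.1 _ (by decide)
    by_cases hxi : x = m + i
    · simp [mergeEdgeBody, Prog.run, NatExpr.eval, RealExpr.eval, hc, h1, h2, h3, h4, h5, hn, hm,
        hxi]
    · simpa [mergeEdgeBody, Prog.run, NatExpr.eval, RealExpr.eval, hc, h1, h2, h3, h4, h5, hn, hm,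
        hxi] using h x (by omega)

theorem copyVertex_spec {s : Store} {n N off : ℕ} (hn : s.nat sizeG 0 = n)
    (hN : s.nat sizeBoth 0 = N) (hoff : s.nat vertexTotal 0 = off) :
    (Prog.forLoop ctr sizeBoth copyVertexBody).Achieves s (N * (copyVertexBody.maxCost + 11) + 8)
      fun t => t.nat vertexTotal 0 = off + N ∧
        (∀ x < off, t.nat codeArr x = s.nat codeArr x ∧ t.nat sideArr x = s.nat sideArr x ∧
          t.real levelArr x = s.real levelArr x) ∧
        ∀ v < N, t.nat codeArr (off + v) = s.nat 1 v ∧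
          t.nat sideArr (off + v) = (if v < n then 1 else 0) ∧
          t.real levelArr (off + v) = s.real 1 (s.nat copyCtr 0) := by
  refine Prog.achieves_forLoop_of_run (fun p t => t.nat vertexTotal 0 = off + p ∧
        (∀ x < off, t.nat codeArr x = s.nat codeArr x ∧ t.nat sideArr x = s.nat sideArr x ∧
          t.real levelArr x = s.real levelArr x) ∧
        ∀ v < p, t.nat codeArr (off + v) = s.nat 1 v ∧
          t.nat sideArr (off + v) = (if v < n then 1 else 0) ∧
          t.real levelArr (off + v) = s.real 1 (s.nat copyCtr 0))
    (by decide) (by decide) (by decide) hN (by simp [hoff]) ?_ (fun t _ h => h)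
  rintro i hi t hA hc ⟨h1, h2, h3⟩
  have e1 : t.nat sizeG = s.nat sizeG := hA.1 _ (by decide)
  have e2 : t.nat 1 = s.nat 1 := hA.1 _ (by decide)
  have e3 : t.real 1 = s.real 1 := hA.2 _ (by decide)
  have e4 : t.nat copyCtr = s.nat copyCtr := hA.1 _ (by decide)
  have hrun : ∀ b, (if i < n then b = 1 else b = 0) → (∀ x < off + i + 1,
      (if x = off + i then s.nat 1 i else t.nat codeArr x)
          = ((copyVertexBody.run t).setNat ctr 0 (i + 1)).nat codeArr x ∧
      (if x = off + i then b else t.nat sideArr x)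
          = ((copyVertexBody.run t).setNat ctr 0 (i + 1)).nat sideArr x ∧
      (if x = off + i then s.real 1 (s.nat copyCtr 0) else t.real levelArr x)
          = ((copyVertexBody.run t).setNat ctr 0 (i + 1)).real levelArr x) ∧
      ((copyVertexBody.run t).setNat ctr 0 (i + 1)).nat vertexTotal 0 = off + (i + 1) := by
    intro b hb
    by_cases hin : i < n
    · rw [if_pos hin] at hb
      simp [copyVertexBody, Prog.run, Test.Holds, NatExpr.eval, RealExpr.eval, hc, h1, e1, e2, e3,
        e4, hn, hin, hb, add_assoc]
    · rw [if_neg hin] at hb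
      simp [copyVertexBody, Prog.run, Test.Holds, NatExpr.eval, RealExpr.eval, hc, h1, e1, e2, e3,
        e4, hn, hin, hb, add_assoc]
  obtain ⟨r, r'⟩ := hrun (if i < n then 1 else 0) (by split_ifs <;> rfl)
  refine ⟨r', fun x hx => ?_, fun v hv => ?_⟩
  · obtain ⟨r1, r2, r3⟩ := r x (by omega)
    rw [← r1, ← r2, ← r3, if_neg (by omega), if_neg (by omega), if_neg (by omega)]
    exact h2 x hx
  · obtain ⟨r1, r2, r3⟩ := r (off + v) (by omega)
    rw [← r1, ← r2, ← r3]
    by_cases hvi : v = i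
    · simp [hvi]
    · simpa [hvi] using h3 v (by omega)

/-- Filtering shifts the positions of the edges. Quantifying over all sums with values in a
commutative monoid describes the listed edges as a multiset and avoids naming those positions. -/
theorem copyEdge_spec {s : Store} {M : ℕ} (hM : s.nat edgesBoth 0 = M) :
    (Prog.forLoop ctr edgesBoth copyEdgeBody).Achieves s (M * (copyEdgeBody.maxCost + 11) + 8)
      fun t => t.nat edgeTotal 0 ≤ s.nat edgeTotal 0 + M ∧
        ∀ (β : Type) [AddCommMonoid β] (g : ℕ → ℕ → β),
          ∑ e ∈ range (t.nat edgeTotal 0), g (t.nat sourceArr e) (t.nat targetArr e)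
            = ∑ e ∈ range (s.nat edgeTotal 0), g (s.nat sourceArr e) (s.nat targetArr e)
              + ∑ e ∈ range M, if s.real 1 (s.nat copyCtr 0) ≤ s.real 2 e then
                  g (s.nat offset 0 + s.nat 2 e) (s.nat offset 0 + s.nat 3 e) else 0 := by
  refine Prog.achieves_forLoop_of_run
    (fun p t => t.nat edgeTotal 0 ≤ s.nat edgeTotal 0 + p ∧
        ∀ (β : Type) [AddCommMonoid β] (g : ℕ → ℕ → β),
          ∑ e ∈ range (t.nat edgeTotal 0), g (t.nat sourceArr e) (t.nat targetArr e)
            = ∑ e ∈ range (s.nat edgeTotal 0), g (s.nat sourceArr e) (s.nat targetArr e)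
              + ∑ e ∈ range p, if s.real 1 (s.nat copyCtr 0) ≤ s.real 2 e then
                  g (s.nat offset 0 + s.nat 2 e) (s.nat offset 0 + s.nat 3 e) else 0)
    (by decide) (by decide) (by decide) hM (by simp) ?_ (fun t _ h => h)
  rintro i hi t hA hc ⟨h1, h2⟩
  have e1 : t.nat offset = s.nat offset := hA.1 _ (by decide)
  have e2 : t.nat 2 = s.nat 2 := hA.1 _ (by decide)
  have e3 : t.nat 3 = s.nat 3 := hA.1 _ (by decide)
  have e4 : t.nat copyCtr = s.nat copyCtr := hA.1 _ (by decide)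
  have e5 : t.real 1 = s.real 1 := hA.2 _ (by decide)
  have e6 : t.real 2 = s.real 2 := hA.2 _ (by decide)
  by_cases h : s.real 1 (s.nat copyCtr 0) ≤ s.real 2 i
  · simp [copyEdgeBody, Prog.run, Test.Holds, NatExpr.eval, RealExpr.eval, hc, e1, e2, e3, e4, e5,
      e6, h]
    refine ⟨by omega, fun β _ g => ?_⟩
    rw [Finset.sum_range_succ, Finset.sum_range_succ, if_pos h, ← add_assoc, ← h2]
    congr 1
    · refine Finset.sum_congr rfl fun e he => ?_
      have := Finset.mem_range.1 he
      rw [if_neg (by omega), if_neg (by omega)]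
    · simp
  · simp [copyEdgeBody, Prog.run, Test.Holds, NatExpr.eval, RealExpr.eval, hc, e4, e5, e6, h]
    refine ⟨by omega, fun β _ g => ?_⟩
    rw [h2, Finset.sum_range_succ, if_neg h, add_zero]

theorem power_spec {s : Store} {N : ℕ} (hN : s.nat vertexTotal 0 = N)
    (h0 : s.nat powerArr 0 = 1) :
    (Prog.forLoop ctr vertexTotal powerBody).Achieves s (N * (powerBody.maxCost + 11) + 8)
      fun t => ∀ x ≤ N, t.nat powerArr x = 2 ^ x := by
  refine Prog.achieves_forLoop_of_run (fun p t => ∀ x ≤ p, t.nat powerArr x = 2 ^ x)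
    (by decide) (by decide) (by decide) hN (by simp [h0]) ?_ (fun t _ h => h)
  intro i hi t hA hc h
  simp [powerBody, Prog.run, NatExpr.eval, hc]
  intro x hx
  split_ifs with hxi
  · rw [h i le_rfl, hxi, pow_succ]; ring
  · exact h x (by omega)

theorem copy_spec {s : Store} {n N M k : ℕ} (hn : s.nat sizeG 0 = n)
    (hN : s.nat sizeBoth 0 = N) (hM : s.nat edgesBoth 0 = M) (hk : s.nat copies 0 = k)
    (hv : s.nat vertexTotal 0 = 0) (he : s.nat edgeTotal 0 = 0) :
    (Prog.forLoop copyCtr copies copyBody).Achieves s (k * (111 * N + 111 * M + 40) + 8)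
      fun t => t.nat vertexTotal 0 = k * N ∧
        (∀ j < k, ∀ v < N, t.nat codeArr (j * N + v) = s.nat 1 v ∧
          t.nat sideArr (j * N + v) = (if v < n then 1 else 0) ∧
          t.real levelArr (j * N + v) = s.real 1 j) ∧
        t.nat edgeTotal 0 ≤ k * M ∧
        ∀ (β : Type) [AddCommMonoid β] (g : ℕ → ℕ → β),
          ∑ e ∈ range (t.nat edgeTotal 0), g (t.nat sourceArr e) (t.nat targetArr e)
            = ∑ j ∈ range k, ∑ e ∈ range M, if s.real 1 j ≤ s.real 2 e then
                  g (j * N + s.nat 2 e) (j * N + s.nat 3 e) else 0 := by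
  -- The 29 covers the assignment of the offset and the overheads of the two inner loops; the
  -- counter adds 11.
  refine Prog.Achieves.mono (T := k * ((111 * N + 111 * M + 29) + 11) + 8)
    (Prog.achieves_forLoop (fun p t => t.nat vertexTotal 0 = p * N ∧
        (∀ j < p, ∀ v < N, t.nat codeArr (j * N + v) = s.nat 1 v ∧
          t.nat sideArr (j * N + v) = (if v < n then 1 else 0) ∧
          t.real levelArr (j * N + v) = s.real 1 j) ∧
        t.nat edgeTotal 0 ≤ p * M ∧
        ∀ (β : Type) [AddCommMonoid β] (g : ℕ → ℕ → β),
          ∑ e ∈ range (t.nat edgeTotal 0), g (t.nat sourceArr e) (t.nat targetArr e)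
            = ∑ j ∈ range p, ∑ e ∈ range M, if s.real 1 j ≤ s.real 2 e then
                  g (j * N + s.nat 2 e) (j * N + s.nat 3 e) else 0)
    (by decide) (by decide) hk (by simp [hv, he]) ?_ (fun t _ h => h)) le_rfl (fun t _ h => h)
  rintro i hi t hA hc ⟨h1, h2, h3, h4⟩
  have E₁ := Exec.setNat t offset (.const 0) (.var vertexTotal)
  have A₁ := E₁.agreeOff
  simp only [NatExpr.eval, h1] at E₁ A₁
  generalize ht₁ : t.setNat offset 0 (i * N) = t₁ at E₁ A₁
  obtain ⟨t₂, c₂, E₂, b₂, v₂, x₂, y₂⟩ := copyVertex_spec (s := t₁) (n := n) (N := N) (off := i * N)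
    (by rw [A₁.1 _ (by decide), hA.1 _ (by decide), hn])
    (by rw [A₁.1 _ (by decide), hA.1 _ (by decide), hN]) (by rw [A₁.1 _ (by decide), h1])
  have A₂ := E₂.agreeOff
  obtain ⟨t₃, c₃, E₃, b₃, e₃, g₃⟩ := copyEdge_spec (s := t₂) (M := M)
    (by rw [A₂.1 _ (by decide), A₁.1 _ (by decide), hA.1 _ (by decide), hM])
  have A₃ := E₃.agreeOff
  have hoff : t₂.nat offset 0 = i * N := by rw [A₂.1 offset (by decide), ← ht₁]; simp
  have hj : t₂.nat copyCtr 0 = i := by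
    rw [A₂.1 copyCtr (by decide), A₁.1 copyCtr (by decide), hc]
  refine ⟨t₃, _, .seq E₁ (.seq E₂ E₃), ?_, ?_⟩
  · have m₁ : N * (copyVertexBody.maxCost + 11) ≤ 111 * N := by
      rw [mul_comm]; exact Nat.mul_le_mul_right _ (by decide)
    have m₂ : M * (copyEdgeBody.maxCost + 11) ≤ 111 * M := by
      rw [mul_comm]; exact Nat.mul_le_mul_right _ (by decide)
    simp only [NatExpr.cost]
    omega
  simp only [Store.setNat_nat, Store.setNat_real]
  refine ⟨?_, fun j hj' v hv => ?_, ?_, fun β _ g => ?_⟩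
  · show t₃.nat vertexTotal 0 = _
    rw [A₃.1 _ (by decide), v₂]; ring
  · show t₃.nat codeArr _ = _ ∧ t₃.nat sideArr _ = _ ∧ _
    rw [A₃.1 codeArr (by decide), A₃.1 sideArr (by decide), A₃.2 levelArr (by decide)]
    rcases Nat.lt_succ_iff_lt_or_eq.1 hj' with hlt | rfl
    · have hle : j * N + v < i * N := by
        have := Nat.mul_le_mul_right N (Nat.succ_le_of_lt hlt)
        rw [Nat.succ_mul] at this
        omega
      obtain ⟨q1, q2, q3⟩ := x₂ _ hle
      rw [q1, q2, q3, A₁.1 codeArr (by decide), A₁.1 sideArr (by decide),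
        A₁.2 levelArr (by decide)]
      exact h2 j hlt v hv
    · obtain ⟨q1, q2, q3⟩ := y₂ v hv
      rw [q1, q2, q3, A₁.1 1 (by decide), A₁.2 1 (by decide), A₁.1 copyCtr (by decide), hc,
        hA.1 1 (by decide), hA.2 1 (by decide)]
      exact ⟨rfl, rfl, rfl⟩
  · show t₃.nat edgeTotal 0 ≤ _
    have : t₂.nat edgeTotal 0 = t.nat edgeTotal 0 := by
      rw [A₂.1 edgeTotal (by decide), A₁.1 edgeTotal (by decide)]
    rw [Nat.succ_mul]
    omega
  · show ∑ e ∈ range (t₃.nat edgeTotal 0), g (t₃.nat sourceArr e) (t₃.nat targetArr e) = _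
    rw [g₃, Finset.sum_range_succ, hoff, hj, A₂.1 edgeTotal (by decide),
      A₁.1 edgeTotal (by decide), A₂.1 sourceArr (by decide), A₁.1 sourceArr (by decide),
      A₂.1 targetArr (by decide), A₁.1 targetArr (by decide), h4, A₂.1 2 (by decide),
      A₁.1 2 (by decide), hA.1 2 (by decide), A₂.1 3 (by decide),
      A₁.1 3 (by decide), hA.1 3 (by decide), A₂.2 1 (by decide),
      A₁.2 1 (by decide), hA.2 1 (by decide), A₂.2 2 (by decide),
      A₁.2 2 (by decide), hA.2 2 (by decide)]

/-! ### The disjoint union and its layout in arrays -/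

/-- The vertex labels of the disjoint union of two graphs. -/
def mergedLabel (G G' : WGraph) (x : ℕ) : ℕ :=
  if x < G.n then labelArray G x else labelArray G' (x - G.n)

/-- The first endpoints of the edges of the disjoint union of two graphs. -/
def mergedSource (G : WGraph) (L : List (Fin G.n × Fin G.n)) (G' : WGraph)
    (L' : List (Fin G'.n × Fin G'.n)) (e : ℕ) : ℕ :=
  if e < L.length then sourceArray G L e else G.n + sourceArray G' L' (e - L.length)

/-- The second endpoints of the edges of the disjoint union of two graphs. -/
def mergedTarget (G : WGraph) (L : List (Fin G.n × Fin G.n)) (G' : WGraph)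
    (L' : List (Fin G'.n × Fin G'.n)) (e : ℕ) : ℕ :=
  if e < L.length then targetArray G L e else G.n + targetArray G' L' (e - L.length)

/-- The edge weights of the disjoint union of two graphs. -/
noncomputable def mergedWeight (G : WGraph) (L : List (Fin G.n × Fin G.n)) (G' : WGraph)
    (L' : List (Fin G'.n × Fin G'.n)) (e : ℕ) : ℝ :=
  if e < L.length then weightArray G L e else weightArray G' L' (e - L.length)

/-- The arrays describe `k` copies of the disjoint union of both graphs, each restricted to the
edges that reach the threshold. -/
structure FlatLayout {k : ℕ} (α : Thresholds k) (G : WGraph) (L : List (Fin G.n × Fin G.n))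
    (G' : WGraph) (L' : List (Fin G'.n × Fin G'.n)) (M : ℕ) (l S src tgt : ℕ → ℕ)
    (A : ℕ → ℝ) : Prop where
  vertex : ∀ j < k, ∀ v < G.n + G'.n, l (j * (G.n + G'.n) + v) = mergedLabel G G' v ∧
    S (j * (G.n + G'.n) + v) = (if v < G.n then 1 else 0) ∧
    A (j * (G.n + G'.n) + v) = extend α.val j
  sum_edges : ∀ (β : Type) [AddCommMonoid β] (g : ℕ → ℕ → β),
    ∑ e ∈ range M, g (src e) (tgt e) = ∑ j ∈ range k, ∑ e ∈ range (L.length + L'.length),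
      if extend α.val j ≤ mergedWeight G L G' L' e then
        g (j * (G.n + G'.n) + mergedSource G L G' L' e) (j * (G.n + G'.n) + mergedTarget G L G' L' e)
      else 0

theorem prepare_spec (h : ℕ) {k : ℕ} (α : Thresholds k) (γ : ℝ) (G : WGraph)
    (L : List (Fin G.n × Fin G.n)) (G' : WGraph) (L' : List (Fin G'.n × Fin G'.n)) :
    prepareProg.Achieves (inputStore h α γ G L G' L')
      (1000 * (k * (G.n + G'.n + (L.length + L'.length) + 1))) fun t =>
        ∃ (M : ℕ) (l S src tgt : ℕ → ℕ) (A : ℕ → ℝ), M ≤ k * (L.length + L'.length) ∧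
          FlatLayout α G L G' L' M l S src tgt A ∧
          FlatInput (k * (G.n + G'.n)) M γ S src tgt A t ∧
          RoundState (k * (G.n + G'.n)) l 0 t ∧ t.nat levels 0 = h + 1 := by
  set s := inputStore h α γ G L G' L' with hs
  obtain ⟨c₁, hc₁, E₁⟩ := Prog.exec_run (p := headerProg) (by decide) s
  have A₁ := E₁.agreeOff
  have H : (headerProg.run s).nat sizeG 0 = G.n ∧ (headerProg.run s).nat edgesG 0 = L.length ∧
      (headerProg.run s).nat sizeH 0 = G'.n ∧ (headerProg.run s).nat edgesH 0 = L'.length ∧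
      (headerProg.run s).nat copies 0 = k ∧ (headerProg.run s).nat levels 0 = h + 1 ∧
      (headerProg.run s).nat sizeBoth 0 = G.n + G'.n ∧
      (headerProg.run s).nat edgesBoth 0 = L.length + L'.length ∧
      (headerProg.run s).nat powerArr 0 = 1 := by
    simp [headerProg, Prog.run, NatExpr.eval, hs, inputStore]
  generalize headerProg.run s = s₁ at E₁ A₁ H
  obtain ⟨x1, x2, x3, x4, x5, x6, x7, x8, x9⟩ := H
  obtain ⟨s₂, c₂, E₂, b₂, l₂⟩ := mergeLabel_spec x1 x3
  have A₂ := E₂.agreeOff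
  obtain ⟨s₃, c₃, E₃, b₃, l₃⟩ := mergeEdge_spec (s := s₂) (n := G.n) (m := L.length)
    (m' := L'.length) (by rw [A₂.1 _ (by decide), x1]) (by rw [A₂.1 _ (by decide), x2])
    (by rw [A₂.1 _ (by decide), x4])
  have A₃ := E₃.agreeOff
  have A₁₃ : s.AgreeOff (headerProg.natWrites ++ [1, 2, 3, ctr]) [2] s₃ :=
    ((A₁.mono (by decide) (by decide)).trans (A₂.mono (by decide) (by decide))).trans
      (A₃.mono (by decide) (by decide))
  have A₁₃' : s₁.AgreeOff [1, 2, 3, ctr] [2] s₃ :=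
    (A₂.mono (by decide) (by decide)).trans (A₃.mono (by decide) (by decide))
  obtain ⟨s₄, c₄, E₄, b₄, v₄, w₄, e₄, g₄⟩ := copy_spec (s := s₃) (n := G.n) (N := G.n + G'.n)
    (M := L.length + L'.length) (k := k) (by rw [A₁₃'.1 _ (by decide), x1])
    (by rw [A₁₃'.1 _ (by decide), x7]) (by rw [A₁₃'.1 _ (by decide), x8])
    (by rw [A₁₃'.1 _ (by decide), x5]) (by rw [A₁₃.1 _ (by decide)]; rfl)
    (by rw [A₁₃.1 _ (by decide)]; rfl)
  have A₄ := E₄.agreeOff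
  obtain ⟨s₅, c₅, E₅, b₅, p₅⟩ := power_spec v₄
    (by rw [A₄.1 _ (by decide), A₁₃'.1 _ (by decide), x9])
  have A₅ := E₅.agreeOff
  have A₁₅ : s.AgreeOff (headerProg.natWrites ++ [1, 2, 3, ctr, copyCtr, offset, vertexTotal,
      edgeTotal, codeArr, sideArr, sourceArr, targetArr, powerArr]) [2, levelArr] s₅ :=
    ((A₁₃.mono (by decide) (by decide)).trans (A₄.mono (by decide) (by decide))).trans
      (A₅.mono (by decide) (by decide))
  have hlabel : ∀ v < G.n + G'.n, s₃.nat 1 v = mergedLabel G G' v := fun v hv => by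
    rw [A₃.1 1 (by decide), l₂ v hv, A₁.1 1 (by decide), A₁.1 4 (by decide)]; rfl
  have hedge : ∀ e < L.length + L'.length, s₃.nat 2 e = mergedSource G L G' L' e ∧
      s₃.nat 3 e = mergedTarget G L G' L' e ∧ s₃.real 2 e = mergedWeight G L G' L' e :=
    fun e he => by
      obtain ⟨q1, q2, q3⟩ := l₃ e he
      rw [q1, q2, q3, A₂.1 2 (by decide), A₁.1 2 (by decide), A₂.1 3 (by decide),
        A₁.1 3 (by decide), A₂.1 5 (by decide), A₁.1 5 (by decide), A₂.1 6 (by decide),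
        A₁.1 6 (by decide), A₂.2 2 (by decide), A₁.2 2 (by decide), A₂.2 3 (by decide),
        A₁.2 3 (by decide)]
      exact ⟨rfl, rfl, rfl⟩
  have hlevel : ∀ j, s₃.real 1 j = extend α.val j := fun j => by
    rw [A₁₃.2 1 (by decide)]; rfl
  refine ⟨s₅, _, .seq E₁ (.seq E₂ (.seq E₃ (.seq E₄ E₅))), ?_, s₄.nat edgeTotal 0,
    s₄.nat codeArr, s₄.nat sideArr, s₄.nat sourceArr, s₄.nat targetArr, s₄.real levelArr, e₄,
    ⟨fun j hj v hv => ?_, fun β _ g => ?_⟩, ⟨?_, ?_, ?_, ?_, ?_, ?_, ?_, p₅⟩,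
    ⟨fun z => ?_, fun c _ => ?_, fun c _ => ?_, fun c _ => ?_, fun c _ => ?_, fun c _ => ?_,
      fun x _ y _ => ?_, ?_⟩, ?_⟩
  · have hk := α.pos
    have m₁ : headerProg.maxCost ≤ 100 := by decide
    have m₂ : mergeLabelBody.maxCost ≤ 100 := by decide
    have m₃ : mergeEdgeBody.maxCost ≤ 100 := by decide
    have m₅ : powerBody.maxCost ≤ 100 := by decide
    have bound : ∀ {n K : ℕ}, K ≤ 100 → n * (K + 11) ≤ 111 * n := fun hK => by
      rw [mul_comm]; exact Nat.mul_le_mul_right _ (by omega)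
    have q₂ := bound m₂ (n := G'.n)
    have q₃ := bound m₃ (n := L'.length)
    have q₅ := bound m₅ (n := k * (G.n + G'.n))
    -- Since `k ≥ 1`, the cost of merging the inputs is absorbed by the cost of the copies.
    have r₂ : G'.n ≤ k * (G.n + G'.n) :=
      (Nat.le_add_left _ _).trans (Nat.le_mul_of_pos_left _ hk)
    have r₃ : L'.length ≤ k * (L.length + L'.length) :=
      (Nat.le_add_left _ _).trans (Nat.le_mul_of_pos_left _ hk)
    have q₄ : k * (111 * (G.n + G'.n) + 111 * (L.length + L'.length) + 40)
      = 111 * (k * (G.n + G'.n)) + 111 * (k * (L.length + L'.length)) + 40 * k := by ring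
    rw [q₄] at b₄
    have : k * (G.n + G'.n + (L.length + L'.length) + 1)
      = k * (G.n + G'.n) + k * (L.length + L'.length) + k := by ring
    rw [this]
    omega
  · rw [← hlabel v hv, ← hlevel]
    exact w₄ j hj v hv
  · rw [g₄]
    refine Finset.sum_congr rfl fun j _ => Finset.sum_congr rfl fun e he => ?_
    obtain ⟨q1, q2, q3⟩ := hedge e (Finset.mem_range.1 he)
    rw [q1, q2, q3, hlevel]
  · rw [A₅.1 _ (by decide), v₄]
  · rw [A₅.1 _ (by decide)]
  · rw [A₅.1 _ (by decide)]
  · rw [A₅.1 _ (by decide)]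
  · rw [A₅.1 _ (by decide)]
  · rw [A₅.2 _ (by decide)]
  · rw [A₁₅.2 _ (by decide)]; rfl
  -- The dictionary, `lastUsed` and the accumulating arrays still hold their initial zeros, and the
  -- codes are the initial labels themselves.
  · rw [A₁₅.1 _ (by decide), A₁₅.1 _ (by decide)]; exact le_rfl
  · rw [A₁₅.1 _ (by decide)]; rfl
  · rw [A₁₅.2 _ (by decide)]; rfl
  · rw [A₁₅.2 _ (by decide)]; rfl
  · rw [A₁₅.2 _ (by decide)]; rfl
  · rw [A₁₅.2 _ (by decide)]; rfl
  · rw [A₅.1 _ (by decide)]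
  · rw [A₁₅.2 _ (by decide)]; rfl
  · rw [A₅.1 _ (by decide), A₄.1 _ (by decide), A₁₃'.1 _ (by decide), x6]

/-! ### The arrays represent the filtration graphs -/

theorem sourceArray_eq {G : WGraph} {L : List (Fin G.n × Fin G.n)} {e : ℕ} (he : e < L.length) :
    sourceArray G L e = L[e].1 := by
  simp [sourceArray, List.getElem?_eq_getElem he]

theorem targetArray_eq {G : WGraph} {L : List (Fin G.n × Fin G.n)} {e : ℕ} (he : e < L.length) :
    targetArray G L e = L[e].2 := by
  simp [targetArray, List.getElem?_eq_getElem he]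

theorem weightArray_eq {G : WGraph} {L : List (Fin G.n × Fin G.n)} {e : ℕ} (he : e < L.length) :
    weightArray G L e = G.weight s(L[e].1, L[e].2) := by
  simp [weightArray, List.getElem?_eq_getElem he]

theorem IsEdgeList.length_eq {G : WGraph} {L : List (Fin G.n × Fin G.n)} (hL : IsEdgeList G L) :
    L.length = G.numEdges := by
  classical
  have h : G.graph.edgeSet = ((L.map fun e => s(e.1, e.2)).toFinset : Set (Sym2 (Fin G.n))) := by
    ext e
    rw [← hL.2 e]
    simp
  rw [WGraph.numEdges, h, Set.ncard_coe_finset, List.toFinset_card_of_nodup hL.1, List.length_map]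

-- An edge appears in exactly one orientation: both orientations have the same unordered pair and
-- would coincide by `Nodup`, which would make the edge a loop.
open Classical in
theorem IsEdgeList.mem_add_mem {G : WGraph} {L : List (Fin G.n × Fin G.n)} (hL : IsEdgeList G L)
    {β : Type} [AddCommMonoid β] (v u : Fin G.n) (b : β) :
    ((if (v, u) ∈ L then b else 0) + if (u, v) ∈ L then b else 0)
      = if G.graph.Adj v u then b else 0 := by
  have hadj : G.graph.Adj v u ↔ (v, u) ∈ L ∨ (u, v) ∈ L := by
    rw [← SimpleGraph.mem_edgeSet, ← hL.2]
    simp only [List.mem_map, Prod.exists]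
    constructor
    · rintro ⟨p, q, hpq, he⟩
      rcases Sym2.eq_iff.1 he with ⟨rfl, rfl⟩ | ⟨rfl, rfl⟩
      · exact .inl hpq
      · exact .inr hpq
    · rintro (h | h)
      · exact ⟨v, u, h, rfl⟩
      · exact ⟨u, v, h, Sym2.eq_swap⟩
  by_cases h : (v, u) ∈ L <;> by_cases h' : (u, v) ∈ L
  · have := List.inj_on_of_nodup_map hL.1 h h' Sym2.eq_swap
    have hvu : v = u := congrArg Prod.fst this
    subst hvu
    exact absurd (hadj.2 (.inl h)) (G.graph.loopless.irrefl v)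
  all_goals simp [hadj, h, h']

-- Double counting: the contribution of a listed pair is spread over the vertices `u` by the
-- indicators of `(v, u)` and `(u, v)`, and the sums are exchanged.
open Classical in
theorem IsEdgeList.sum_eq {G : WGraph} {L : List (Fin G.n × Fin G.n)} (hL : IsEdgeList G L)
    (a : ℝ) (v : Fin G.n) {β : Type} (f : ℕ → β) :
    (∑ e ∈ range L.length, if a ≤ weightArray G L e then
      ((if sourceArray G L e = v then ({f (targetArray G L e)} : Multiset β) else 0)
        + if targetArray G L e = v then {f (sourceArray G L e)} else 0) else 0)
      = ∑ u : Fin G.n, if (G.filtrationGraph a).Adj v u then {f u} else 0 := by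
  have hnd : L.Nodup := List.Nodup.of_map _ hL.1
  have h1 : (∑ e ∈ range L.length, if a ≤ weightArray G L e then
      ((if sourceArray G L e = v then ({f (targetArray G L e)} : Multiset β) else 0)
        + if targetArray G L e = v then {f (sourceArray G L e)} else 0) else 0)
      = ∑ e ∈ L.toFinset, if a ≤ G.weight s(e.1, e.2) then
      ((if e.1 = v then ({f e.2} : Multiset β) else 0)
        + if e.2 = v then {f e.1} else 0) else 0 := by
    rw [List.sum_toFinset _ hnd, ← Fin.sum_univ_fun_getElem, Finset.sum_range]
    refine Finset.sum_congr rfl fun e _ => ?_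
    rw [sourceArray_eq e.isLt, targetArray_eq e.isLt, weightArray_eq e.isLt]
    simp [Fin.ext_iff]
  have h2 : ∀ e : Fin G.n × Fin G.n, (if a ≤ G.weight s(e.1, e.2) then
      ((if e.1 = v then ({f e.2} : Multiset β) else 0)
        + if e.2 = v then {f e.1} else 0) else 0)
      = ∑ u : Fin G.n, ((if e = (v, u) then (if a ≤ G.weight s(v, u) then {f u} else 0) else 0)
        + if e = (u, v) then (if a ≤ G.weight s(v, u) then {f u} else 0) else 0) := by
    rintro ⟨p, q⟩
    rw [Finset.sum_add_distrib]
    have e1 : (∑ u : Fin G.n, if (p, q) = (v, u) then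
        (if a ≤ G.weight s(v, u) then ({f u} : Multiset β) else 0) else 0)
        = if p = v then (if a ≤ G.weight s(v, q) then {f q} else 0) else 0 := by
      simp only [Prod.mk.injEq, ite_and]
      by_cases hp : p = v <;> simp [hp]
    have e2 : (∑ u : Fin G.n, if (p, q) = (u, v) then
        (if a ≤ G.weight s(v, u) then ({f u} : Multiset β) else 0) else 0)
        = if q = v then (if a ≤ G.weight s(v, p) then {f p} else 0) else 0 := by
      simp only [Prod.mk.injEq, and_comm (a := p = _), ite_and]
      by_cases hp : q = v <;> simp [hp]
    rw [e1, e2]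
    by_cases hp : p = v <;> by_cases hq : q = v
    · subst hp; subst hq; simp only [if_true]; split_ifs <;> simp
    · subst hp; simp [hq]
    · subst hq; simp [hp, Sym2.eq_swap (a := p)]
    · simp [hp, hq]
  rw [h1, Finset.sum_congr rfl fun e _ => h2 e, Finset.sum_comm]
  refine Finset.sum_congr rfl fun u _ => ?_
  rw [Finset.sum_add_distrib, Finset.sum_ite_eq', Finset.sum_ite_eq']
  simp only [List.mem_toFinset]
  rw [hL.mem_add_mem, ← ite_and]
  exact if_congr Iff.rfl rfl rfl

/-! ### Index arithmetic of the copies -/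

theorem copy_index_inj {N j j' v v' : ℕ} (hv : v < N) (hv' : v' < N) :
    j * N + v = j' * N + v' ↔ j = j' ∧ v = v' :=
  ⟨fun h => eq_of_add_mul_eq hv hv' h, by rintro ⟨rfl, rfl⟩; rfl⟩

theorem copy_index_lt {N k j v : ℕ} (hj : j < k) (hv : v < N) : j * N + v < k * N :=
  calc j * N + v < (j + 1) * N := by rw [Nat.succ_mul]; omega
    _ ≤ k * N := Nat.mul_le_mul_right _ hj

theorem exists_copy_index {N k x : ℕ} (hx : x < k * N) :
    ∃ j < k, ∃ v < N, x = j * N + v := by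
  have hN : 0 < N := Nat.pos_of_ne_zero fun h => by simp [h] at hx
  exact ⟨x / N, Nat.div_lt_of_lt_mul (by rwa [mul_comm]), x % N, Nat.mod_lt _ hN,
    by rw [mul_comm, Nat.div_add_mod]⟩

theorem sum_range_copies {β : Type*} [AddCommMonoid β] (N k : ℕ) (F : ℕ → β) :
    ∑ x ∈ range (k * N), F x = ∑ j ∈ range k, ∑ v ∈ range N, F (j * N + v) := by
  induction k with
  | zero => simp
  | succ k ih => rw [Nat.succ_mul, Finset.sum_range_add, ih, Finset.sum_range_succ]

section Layout

variable {k : ℕ} {α : Thresholds k} {G G' : WGraph} {L : List (Fin G.n × Fin G.n)}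
  {L' : List (Fin G'.n × Fin G'.n)} {M : ℕ} {l S src tgt : ℕ → ℕ} {A : ℕ → ℝ}

theorem mergedSource_lt {e : ℕ} (he : e < L.length + L'.length) :
    mergedSource G L G' L' e < G.n + G'.n := by
  unfold mergedSource
  split_ifs with h
  · rw [sourceArray_eq h]; omega
  · rw [sourceArray_eq (show e - L.length < L'.length by omega)]; omega

theorem mergedTarget_lt {e : ℕ} (he : e < L.length + L'.length) :
    mergedTarget G L G' L' e < G.n + G'.n := by
  unfold mergedTarget
  split_ifs with h
  · rw [targetArray_eq h]; omega
  · rw [targetArray_eq (show e - L.length < L'.length by omega)]; omega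

/-- The sum identity is applied to the indicator of an end point out of range. The right side is
zero, so every summand on the left is zero. -/
theorem FlatLayout.edge_lt (H : FlatLayout α G L G' L' M l S src tgt A) {e : ℕ} (he : e < M) :
    src e < k * (G.n + G'.n) ∧ tgt e < k * (G.n + G'.n) := by
  have h := H.sum_edges ℕ
    fun a b => if a < k * (G.n + G'.n) ∧ b < k * (G.n + G'.n) then 0 else 1
  rw [Finset.sum_eq_zero (s := range k)] at h
  · by_contra hn
    have := Finset.sum_eq_zero_iff.1 h e (Finset.mem_range.2 he)
    rw [if_neg hn] at this
    exact one_ne_zero this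
  · intro j hj
    refine Finset.sum_eq_zero fun e he => ?_
    have hj := Finset.mem_range.1 hj
    have he := Finset.mem_range.1 he
    simp [copy_index_lt hj (mergedSource_lt he), copy_index_lt hj (mergedTarget_lt he)]

/-- The sum identity is applied with values in multisets; vertices of different copies have
different indices, so only copy `j` survives. -/
theorem FlatLayout.neighborValues_eq (H : FlatLayout α G L G' L' M l S src tgt A) {β : Type}
    (f : ℕ → β) {j v : ℕ} (hj : j < k) (hv : v < G.n + G'.n) :
    neighborValues M src tgt f (j * (G.n + G'.n) + v) = ∑ e ∈ range (L.length + L'.length),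
      if extend α.val j ≤ mergedWeight G L G' L' e then
        ((if mergedSource G L G' L' e = v then
            {f (j * (G.n + G'.n) + mergedTarget G L G' L' e)} else 0)
          + if mergedTarget G L G' L' e = v then
            {f (j * (G.n + G'.n) + mergedSource G L G' L' e)} else 0) else 0 := by
  rw [neighborValues, H.sum_edges (Multiset β) fun a b =>
    (if a = j * (G.n + G'.n) + v then {f b} else 0)
      + if b = j * (G.n + G'.n) + v then {f a} else 0, Finset.sum_eq_single j]
  · refine Finset.sum_congr rfl fun e he => ?_
    have he := Finset.mem_range.1 he
    simp only [Nat.add_left_cancel_iff]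
  · intro j' _ hne
    refine Finset.sum_eq_zero fun e he => ?_
    have he := Finset.mem_range.1 he
    simp [copy_index_inj (mergedSource_lt he) hv, copy_index_inj (mergedTarget_lt he) hv, hne]
  · intro h
    exact absurd (Finset.mem_range.2 hj) h

open Classical in
theorem FlatLayout.neighborValues_fst (H : FlatLayout α G L G' L' M l S src tgt A)
    (hL : IsEdgeList G L) {β : Type} (f : ℕ → β) (j : Fin k) (v : Fin G.n) :
    neighborValues M src tgt f (j * (G.n + G'.n) + v)
      = ∑ u : Fin G.n, if (G.filtrationGraph (α.val j)).Adj v u then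
          {f (j * (G.n + G'.n) + u)} else 0 := by
  rw [H.neighborValues_eq f j.isLt (by omega), extend_val, Finset.sum_range_add,
    Finset.sum_eq_zero (s := range L'.length), add_zero,
    ← hL.sum_eq (α.val j) v (fun u => f (j * (G.n + G'.n) + u))]
  · refine Finset.sum_congr rfl fun e he => ?_
    have he := Finset.mem_range.1 he
    simp [mergedSource, mergedTarget, mergedWeight, he]
  · intro e _
    have h2 : ∀ x, ¬ G.n + x = (v : ℕ) := fun x => by omega
    simp [mergedSource, mergedTarget, h2]

open Classical in
theorem FlatLayout.neighborValues_snd (H : FlatLayout α G L G' L' M l S src tgt A)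
    (hL' : IsEdgeList G' L') {β : Type} (f : ℕ → β) (j : Fin k) (v : Fin G'.n) :
    neighborValues M src tgt f (j * (G.n + G'.n) + (G.n + v))
      = ∑ u : Fin G'.n, if (G'.filtrationGraph (α.val j)).Adj v u then
          {f (j * (G.n + G'.n) + (G.n + u))} else 0 := by
  rw [H.neighborValues_eq f j.isLt (by omega), extend_val, Finset.sum_range_add,
    Finset.sum_eq_zero (s := range L.length), zero_add,
    ← hL'.sum_eq (α.val j) v (fun u => f (j * (G.n + G'.n) + (G.n + u)))]
  · refine Finset.sum_congr rfl fun e he => ?_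
    simp [mergedSource, mergedTarget, mergedWeight]
  · intro e he
    have he := Finset.mem_range.1 he
    have h1 : ¬ sourceArray G L e = G.n + v := by rw [sourceArray_eq he]; omega
    have h2 : ¬ targetArray G L e = G.n + v := by rw [targetArray_eq he]; omega
    simp [mergedSource, mergedTarget, he, h1, h2]

theorem map_val_eq_sum {ι β : Type} (s : Finset ι) (f : ι → β) :
    s.val.map f = ∑ u ∈ s, {f u} := by
  rw [Finset.sum, ← Multiset.sum_map_singleton (s.val.map f), Multiset.map_map]
  rfl

/-- Copies are not joined by edges, so relabelling the large graph relabels all filtration graphs at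
once, with labels comparable across thresholds and across both inputs. -/
theorem FlatLayout.arrayLabel_eq (H : FlatLayout α G L G' L' M l S src tgt A)
    (hL : IsEdgeList G L) (hL' : IsEdgeList G' L') (i : ℕ) (j : Fin k) :
    (∀ v : Fin G.n, arrayLabel l M src tgt i (j * (G.n + G'.n) + v)
      = wlLabel (G.filtrationGraph (α.val j)) G.label i v) ∧
    ∀ v : Fin G'.n, arrayLabel l M src tgt i (j * (G.n + G'.n) + (G.n + v))
      = wlLabel (G'.filtrationGraph (α.val j)) G'.label i v := by
  classical
  induction i with
  | zero =>
    refine ⟨fun v => ?_, fun v => ?_⟩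
    · refine (H.vertex j j.isLt v (by omega)).1.trans ?_
      simp [mergedLabel, labelArray, wlLabel]
    · refine (H.vertex j j.isLt (G.n + v) (by omega)).1.trans ?_
      simp [mergedLabel, labelArray, wlLabel]
  | succ i ih =>
    refine ⟨fun v => ?_, fun v => ?_⟩
    · refine Prod.ext (ih.1 v) ?_
      change neighborValues M src tgt _ _ = _
      rw [H.neighborValues_fst hL, ← Finset.sum_filter]
      simp only [ih.1]
      refine (map_val_eq_sum _ _).symm.trans ?_
      simp only [wlLabel]
    · refine Prod.ext (ih.2 v) ?_
      change neighborValues M src tgt _ _ = _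
      rw [H.neighborValues_snd hL', ← Finset.sum_filter]
      simp only [ih.2]
      refine (map_val_eq_sum _ _).symm.trans ?_
      simp only [wlLabel]

/-- Simplicity of the graphs enters here: it bounds the multiplicities that have to fit into the
fields of a code. -/
theorem FlatLayout.nodup (H : FlatLayout α G L G' L' M l S src tgt A)
    (hL : IsEdgeList G L) (hL' : IsEdgeList G' L') {x : ℕ} (hx : x < k * (G.n + G'.n)) :
    (neighborValues M src tgt id x).Nodup := by
  classical
  obtain ⟨j, hj, v, hv, rfl⟩ := exists_copy_index hx
  by_cases h : v < G.n
  · have := H.neighborValues_fst hL id ⟨j, hj⟩ ⟨v, h⟩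
    simp only at this
    rw [this, ← Finset.sum_filter, ← map_val_eq_sum]
    refine Multiset.Nodup.map (fun a b hab => ?_) (Finset.nodup _)
    simpa [Fin.ext_iff] using hab
  · obtain ⟨w, rfl⟩ := Nat.exists_eq_add_of_le (not_lt.1 h)
    have := H.neighborValues_snd hL' id ⟨j, hj⟩ ⟨w, by omega⟩
    simp only at this
    rw [this, ← Finset.sum_filter, ← map_val_eq_sum]
    refine Multiset.Nodup.map (fun a b hab => ?_) (Finset.nodup _)
    simpa [Fin.ext_iff] using hab

end Layout

/-! ### The contributions of the labels -/

section Layout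

variable {k : ℕ} {α : Thresholds k} {G G' : WGraph} {L : List (Fin G.n × Fin G.n)}
  {L' : List (Fin G'.n × Fin G'.n)} {M : ℕ} {l S src tgt : ℕ → ℕ} {A : ℕ → ℝ}

open Classical in
/-- The vertices of all copies that carry a given label. -/
noncomputable def labelClass (l : ℕ → ℕ) (M : ℕ) (src tgt : ℕ → ℕ) (N : ℕ) (f : WLFeature) :
    Finset ℕ :=
  {x ∈ range N | arrayLabel l M src tgt f.1 x = f.2}

open Classical in
theorem mem_labelClass {N : ℕ} {f : WLFeature} {x : ℕ} :
    x ∈ labelClass l M src tgt N f ↔ x < N ∧ arrayLabel l M src tgt f.1 x = f.2 :=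
  Finset.mem_filter.trans (and_congr_left' Finset.mem_range)

theorem sum_ite_eq_card_mul {n : ℕ} (P : Fin n → Prop) [DecidablePred P] (c : ℝ) :
    (∑ v : Fin n, if P v then c else 0) = (#{v | P v} : ℝ) * c := by
  rw [← Finset.sum_filter, Finset.sum_const, nsmul_eq_mul]

/-- The free weights serve three purposes: (1, 0) and (0, 1) give the two masses, and the reciprocal
masses with opposite signs give the signed mass. -/
theorem FlatLayout.sum_class (H : FlatLayout α G L G' L' M l S src tgt A)
    (hL : IsEdgeList G L) (hL' : IsEdgeList G' L') (f : WLFeature) (c c' : ℝ) {t : ℕ}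
    (ht : t ≤ k) :
    (∑ x ∈ range (t * (G.n + G'.n)),
      if x ∈ labelClass l M src tgt (k * (G.n + G'.n)) f then if S x = 1 then c else c' else 0)
      = ∑ j ∈ range t, (extend (wlHistogram α G f) j * c + extend (wlHistogram α G' f) j * c') := by
  classical
  rw [sum_range_copies]
  refine Finset.sum_congr rfl fun j hj => ?_
  have hj : j < k := (Finset.mem_range.1 hj).trans_le ht
  have hS : ∀ v < G.n + G'.n, S (j * (G.n + G'.n) + v) = if v < G.n then 1 else 0 :=
    fun v hv => (H.vertex j hj v hv).2.1
  have hlab := H.arrayLabel_eq hL hL' f.1 ⟨j, hj⟩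
  rw [Finset.sum_range_add, Finset.sum_range, Finset.sum_range, extend, extend, dif_pos hj,
    dif_pos hj, wlHistogram, wlHistogram, ← sum_ite_eq_card_mul, ← sum_ite_eq_card_mul]
  congr 1
  · refine Finset.sum_congr rfl fun v _ => ?_
    have hv : (v : ℕ) < G.n + G'.n := by omega
    have hlv := hlab.1 v
    simp only at hlv
    simp [mem_labelClass, copy_index_lt hj hv, hlv, hS v hv]
  · refine Finset.sum_congr rfl fun v _ => ?_
    have hv : G.n + (v : ℕ) < G.n + G'.n := by omega
    have hlv := hlab.2 v
    simp only at hlv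
    simp [mem_labelClass, copy_index_lt hj hv, hlv, hS _ hv]

theorem wlHistogram_nonneg (α : Thresholds k) (G : WGraph) (f : WLFeature) (j : Fin k) :
    0 ≤ wlHistogram α G f j := Nat.cast_nonneg _

theorem norm1_wlHistogram (α : Thresholds k) (G : WGraph) (f : WLFeature) :
    norm1 (wlHistogram α G f) = ∑ j ∈ range k, extend (wlHistogram α G f) j := by
  rw [Finset.sum_range]
  exact Finset.sum_congr rfl fun j _ => by
    rw [abs_of_nonneg (wlHistogram_nonneg α G f j), extend_val]

theorem sum_range_class {N : ℕ} (f : WLFeature) (F : ℕ → ℝ) :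
    (∑ x ∈ range N, if x ∈ labelClass l M src tgt N f then F x else 0)
      = ∑ x ∈ labelClass l M src tgt N f, F x := by
  rw [← Finset.sum_filter]
  refine Finset.sum_congr ?_ fun _ _ => rfl
  ext x
  rw [Finset.mem_filter, Finset.mem_range, mem_labelClass]
  tauto

theorem FlatLayout.massOne_eq (H : FlatLayout α G L G' L' M l S src tgt A)
    (hL : IsEdgeList G L) (hL' : IsEdgeList G' L') (f : WLFeature) :
    (massOne S (labelClass l M src tgt (k * (G.n + G'.n)) f) : ℝ) = norm1 (wlHistogram α G f) := by
  have h := H.sum_class hL hL' f 1 0 le_rfl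
  rw [sum_range_class, ← Finset.sum_filter, Finset.sum_const, nsmul_eq_mul, mul_one, ← massOne] at h
  rw [h, norm1_wlHistogram]
  simp

theorem FlatLayout.massTwo_eq (H : FlatLayout α G L G' L' M l S src tgt A)
    (hL : IsEdgeList G L) (hL' : IsEdgeList G' L') (f : WLFeature) :
    (massTwo S (labelClass l M src tgt (k * (G.n + G'.n)) f) : ℝ)
      = norm1 (wlHistogram α G' f) := by
  have h := H.sum_class hL hL' f 0 1 le_rfl
  simp only [← ite_not (S _ = 1)] at h
  rw [sum_range_class, ← Finset.sum_filter, Finset.sum_const, nsmul_eq_mul, mul_one] at h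
  rw [massTwo, h, norm1_wlHistogram]
  simp

theorem extend_normalize (x : Fin k → ℝ) (j : ℕ) :
    extend (normalize x) j = extend x j / norm1 x := by
  unfold extend
  split_ifs
  · rfl
  · simp

theorem sum_normalize_wlHistogram {f : WLFeature} (h : norm1 (wlHistogram α G f) ≠ 0) :
    ∑ i, normalize (wlHistogram α G f) i = 1 := by
  unfold normalize
  rw [← Finset.sum_div, div_eq_one_iff_eq h]
  exact Finset.sum_congr rfl fun j _ => (abs_of_nonneg (wlHistogram_nonneg α G f j)).symm

theorem normalize_wlHistogram_nonneg (f : WLFeature) (i : Fin k) :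
    0 ≤ normalize (wlHistogram α G f) i :=
  div_nonneg (wlHistogram_nonneg α G f i) (Finset.sum_nonneg fun _ _ => abs_nonneg _)

theorem FlatLayout.signedMass_eq (H : FlatLayout α G L G' L' M l S src tgt A)
    (hL : IsEdgeList G L) (hL' : IsEdgeList G' L') (f : WLFeature) {t : ℕ} (ht : t ≤ k) :
    signedMass S (labelClass l M src tgt (k * (G.n + G'.n)) f) (t * (G.n + G'.n))
      = cumul (normalize (wlHistogram α G f)) t - cumul (normalize (wlHistogram α G' f)) t := by
  rw [signedMass, H.sum_class hL hL' f _ _ ht, cumul_eq_sum_range _ ht, cumul_eq_sum_range _ ht,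
    ← Finset.sum_sub_distrib]
  refine Finset.sum_congr rfl fun j _ => ?_
  rw [extend_normalize, extend_normalize, H.massOne_eq hL hL', H.massTwo_eq hL hL']
  ring

/-- The level is constant within a copy, so only the last vertex of each copy contributes. There the
signed mass is the difference of the cumulated normalized histograms, and the sum becomes the closed
form of `wasserstein_eq`. -/
theorem FlatLayout.partialDist_eq (H : FlatLayout α G L G' L' M l S src tgt A)
    (hL : IsEdgeList G L) (hL' : IsEdgeList G' L') {f : WLFeature}
    (hf : norm1 (wlHistogram α G f) ≠ 0) (hf' : norm1 (wlHistogram α G' f) ≠ 0) :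
    partialDist S A (labelClass l M src tgt (k * (G.n + G'.n)) f) (k * (G.n + G'.n))
      = wasserstein α.val (normalize (wlHistogram α G f)) (normalize (wlHistogram α G' f)) := by
  have hsum := (sum_normalize_wlHistogram hf).trans (sum_normalize_wlHistogram hf').symm
  rw [wasserstein_eq α.anti (normalize_wlHistogram_nonneg f) (normalize_wlHistogram_nonneg f) hsum,
    partialDist, sum_range_copies]
  -- A copy needs a last vertex; with no vertices at all the masses would be zero.
  have hN : G.n + G'.n ≠ 0 := fun h => hf (by
    rw [← H.massOne_eq hL hL' f, h]
    simp [labelClass, massOne])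
  obtain ⟨N, hN⟩ := Nat.exists_eq_succ_of_ne_zero hN
  have hA := fun j hj v hv => (H.vertex j hj v hv).2.2
  have hm := fun t ht => H.signedMass_eq hL hL' f (t := t) ht
  rw [hN] at hA hm ⊢
  refine Finset.sum_congr rfl fun j hj => ?_
  have hj := Finset.mem_range.1 hj
  rw [Finset.sum_range_succ, Finset.sum_eq_zero, zero_add, hA j hj N (Nat.lt_succ_self N),
    show j * N.succ + N + 1 = (j + 1) * N.succ by rw [Nat.succ_mul]; rfl, hm (j + 1) hj]
  -- After the last copy `A` is unspecified, but the signed mass there is zero.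
  · by_cases hjk : j + 1 < k
    · have := hA (j + 1) hjk 0 (Nat.succ_pos N)
      rw [add_zero] at this
      rw [this]
    · have hjk : j + 1 = k := by omega
      rw [hjk, cumul_self, cumul_self, hsum]
      simp
  · intro v hv
    have hv := Finset.mem_range.1 hv
    rw [add_assoc, hA j hj v (by omega), hA j hj (v + 1) (by omega)]
    simp

/-- The term of the filtration kernel that belongs to a feature. -/
noncomputable def featureTerm (α : Thresholds k) (γ : ℝ) (G G' : WGraph) (f : WLFeature) : ℝ :=
  baseKernel α.val γ (wlHistogram α G f) (wlHistogram α G' f) * norm1 (wlHistogram α G f)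
    * norm1 (wlHistogram α G' f)

theorem FlatLayout.classTerm_eq (H : FlatLayout α G L G' L' M l S src tgt A)
    (hL : IsEdgeList G L) (hL' : IsEdgeList G' L') (γ : ℝ) (f : WLFeature) :
    classTerm γ S A (k * (G.n + G'.n)) (labelClass l M src tgt (k * (G.n + G'.n)) f)
      = featureTerm α γ G G' f := by
  rw [classTerm, featureTerm, H.massOne_eq hL hL', H.massTwo_eq hL hL', baseKernel]
  by_cases hf : norm1 (wlHistogram α G f) = 0
  · simp [hf]
  by_cases hf' : norm1 (wlHistogram α G' f) = 0
  · simp [hf']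
  rw [H.partialDist_eq hL hL' hf hf']

/-- A feature outside the labels attained in the layout has an empty class and hence a zero term, so
the sum over all features reduces to a finite one, grouped by rounds. -/
theorem FlatLayout.partialKernel_eq (H : FlatLayout α G L G' L' M l S src tgt A)
    (hL : IsEdgeList G L) (hL' : IsEdgeList G' L') (γ : ℝ) (i₀ h : ℕ) :
    partialKernel γ S l A (k * (G.n + G'.n)) M src tgt i₀ (h + 1) = wlKernel i₀ h α γ G G' := by
  classical
  let V : Finset WLFeature := ((range (h + 1)).filter (¬ · < i₀)).sigma fun i =>
    (range (k * (G.n + G'.n))).image (arrayLabel l M src tgt i)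
  have hV : wlKernel i₀ h α γ G G' = ∑ f ∈ V, featureTerm α γ G G' f := by
    refine finsum_mem_eq_sum_of_inter_support_eq _ ?_
    ext f
    simp only [Set.mem_inter_iff, Function.mem_support, wlFeatures, Set.mem_ofPred_eq,
      Finset.mem_coe]
    refine and_congr_left fun hne => ?_
    have hmem : f.2 ∈ (range (k * (G.n + G'.n))).image (arrayLabel l M src tgt f.1) := by
      by_contra hn
      refine hne ?_
      change featureTerm α γ G G' f = 0
      rw [← H.classTerm_eq hL hL', labelClass, Finset.filter_eq_empty_iff.2, classTerm_empty]
      exact fun x hx hxf => hn (Finset.mem_image.2 ⟨x, hx, hxf⟩)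
    simp only [V, Finset.mem_sigma, hmem, and_true, Finset.mem_filter, Finset.mem_range]
    omega
  rw [hV, Finset.sum_sigma, Finset.sum_filter, partialKernel]
  refine Finset.sum_congr rfl fun i _ => ?_
  rw [ite_not]
  refine if_congr Iff.rfl rfl ?_
  rw [roundSum]
  refine Finset.sum_congr (by congr) fun a _ => ?_
  rw [← H.classTerm_eq hL hL']
  congr

end Layout

/-! ### The complete program and its running time -/

/-- The vertices of a graph without isolated vertices are at most twice as many as its edges. -/
theorem WGraph.NoIsolated.size_le {G : WGraph} (hG : G.NoIsolated) : G.n ≤ 2 * G.numEdges := by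
  classical
  have h1 : ∑ v, G.graph.degree v = 2 * #G.graph.edgeFinset :=
    G.graph.sum_degrees_eq_twice_card_edges
  have h2 : G.numEdges = #G.graph.edgeFinset := by
    rw [WGraph.numEdges, ← SimpleGraph.coe_edgeFinset, Set.ncard_coe_finset]
  rw [h2, ← h1]
  calc G.n = ∑ _v : Fin G.n, 1 := by simp
    _ ≤ _ := Finset.sum_le_sum fun v _ => by
      obtain ⟨u, hu⟩ := hG v
      exact (G.graph.degree_pos_iff_exists_adj v).2 ⟨u, hu⟩

/-- The program that computes the Weisfeiler-Lehman filtration kernel. -/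
def kernelProg (i₀ : ℕ) : Prog :=
  -- Arrays 32 and 15 are `levelCtr` and `levels`; the latter holds `h + 1`, for the rounds 0 to h.
  .seq prepareProg (.forLoop 32 15 (roundBody i₀))

theorem kernelProg_spec (i₀ h : ℕ) {k : ℕ} (α : Thresholds k) (γ : ℝ) {G G' : WGraph}
    {L : List (Fin G.n × Fin G.n)} {L' : List (Fin G'.n × Fin G'.n)} (hL : IsEdgeList G L)
    (hL' : IsEdgeList G' L') :
    (kernelProg i₀).Achieves (inputStore h α γ G L G' L')
      (3000 * (h + 1) * k * (G.n + G'.n + (L.length + L'.length) + 1)) fun t =>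
        t.output = wlKernel i₀ h α γ G G' := by
  obtain ⟨s₁, t₁, E₁, b₁, M, l, S, src, tgt, A, hM, H, hF, hR, hlev⟩ :=
    prepare_spec h α γ G L G' L'
  obtain ⟨s₂, t₂, E₂, b₂, r₂⟩ := rounds_spec i₀ (fun e he => (H.edge_lt he).1)
    (fun e he => (H.edge_lt he).2) (fun x hx => H.nodup hL hL' hx) hlev hF hR
  refine ⟨s₂, _, .seq E₁ E₂, ?_, r₂.trans (H.partialKernel_eq hL hL' γ i₀ h)⟩
  have hk := α.pos
  set N := G.n + G'.n
  set K := L.length + L'.length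
  have h1 : k * N + M + 1 ≤ k * (N + K + 1) := by
    have : k * (N + K + 1) = k * N + k * K + k := by ring
    omega
  have h2 : 1 ≤ k * (N + K + 1) := Nat.mul_pos hk (Nat.succ_pos _)
  have h3 : 3000 * (h + 1) * k * (N + K + 1) = 3000 * ((h + 1) * (k * (N + K + 1))) := by ring
  generalize k * (N + K + 1) = X at *
  rw [h3]
  -- With `X = k * (N + K + 1)`, preparation costs at most 1000 X and the rounds at most 1011 (h +
  -- 1) X + 8, together below 3000 (h + 1) X.
  have h4 : (h + 1) * (1000 * (k * N + M + 1) + 11) ≤ (h + 1) * (1011 * X) :=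
    Nat.mul_le_mul_left _ (by omega)
  have h5 : (h + 1) * (1011 * X) = 1011 * ((h + 1) * X) := by ring
  have h6 : X ≤ (h + 1) * X := Nat.le_mul_of_pos_left _ (Nat.succ_pos h)
  omega

end WLFilt

theorem mainTheorem5 :
    ∀ i₀ : ℕ, i₀ ≤ 1 → ∃ (P : WLFilt.Prog) (C : ℕ),
      ∀ (h k : ℕ) (α : WLFilt.Thresholds k) (γ : ℝ), 0 ≤ γ →
      ∀ (G G' : WLFilt.WGraph)
        (L : List (Fin G.n × Fin G.n)) (L' : List (Fin G'.n × Fin G'.n)),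
        WLFilt.IsEdgeList G L → WLFilt.IsEdgeList G' L' →
        ∃ (s : WLFilt.Store) (t : ℕ),
          WLFilt.Exec P (WLFilt.inputStore h α γ G L G' L') s t ∧
          s.output = WLFilt.wlKernel i₀ h α γ G G' ∧
          t ≤ C * (h + 1) * k * ((G.n + G'.n) + (G.numEdges + G'.numEdges) + 1) ∧
          (1 ≤ h → 1 ≤ G.numEdges + G'.numEdges → G.NoIsolated → G'.NoIsolated →
            t ≤ C * h * k * (G.numEdges + G'.numEdges)) := by
  intro i₀ _
  -- The constant is 3000 · 2 · 4: h + 1 ≤ 2h for h ≥ 1, and n + m + 1 ≤ 4m because n ≤ 2m and m ≥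
  -- 1.
  refine ⟨WLFilt.kernelProg i₀, 24000, fun h k α γ _ G G' L L' hL hL' => ?_⟩
  obtain ⟨s, t, hE, ht, hs⟩ := WLFilt.kernelProg_spec i₀ h α γ hL hL'
  rw [hL.length_eq, hL'.length_eq] at ht
  refine ⟨s, t, hE, hs, ht.trans ?_, fun hh hm hG hG' => ht.trans ?_⟩
  · gcongr
    norm_num
  · have h1 := hG.size_le
    have h2 := hG'.size_le
    calc 3000 * (h + 1) * k * (G.n + G'.n + (G.numEdges + G'.numEdges) + 1)
        ≤ 3000 * (2 * h) * k * (4 * (G.numEdges + G'.numEdges)) := by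
          gcongr <;> omega
      _ = 24000 * h * k * (G.numEdges + G'.numEdges) := by ring
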